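/- **Theorem (global and linear convergence of Bregman Finito/MISO with an essentially cyclic rule).** Let $N\ge 1$, $f_i,h_i:\mathbb R^n\to\mathbb R\cup\{\infty\}$ ($i\in[N]=\{1,\dots,N\}$), $g:\mathbb R^n\to\mathbb R\cup\{\infty\}$, and let $\varphi=\frac1N\sum_{i=1}^N f_i+g$, $C=\bigcap_{i=1}^N\operatorname{int}\operatorname{dom}h_i$. *Definitions.* A Legendre kernel is a proper, lsc, strictly convex function $h$ with $\operatorname{int}\operatorname{dom}h\ne\emptyset$, $C^1$ on $\operatorname{int}\operatorname{dom}h$, such that $h(x)/\|x\|\to\infty$ as $\|x\|\to\infty$ and $\|\nabla h(x_k)\|\to\infty$ whenever $\operatorname{int}\operatorname{dom}h\ni x_k\to x\in\operatorname{bdry}\operatorname{dom}h$. A proper lsc function $f$ is $L$-smooth relative to a Legendre kernel $h$ (with $L\ge0$) if $\operatorname{dom}f\supseteq\operatorname{dom}h$ and $Lh\pm f$ are convex on $\operatorname{int}\operatorname{dom}h$. The regular subdifferential $\hat\partial q(x)$, at a point $x$ where $q$ is finite, is the set of $v$ with $\liminf_{x\ne y\to x}\frac{q(y)-q(x)-\langle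 v,y-x\rangle}{\|y-x\|}\ge0$. The limiting subdifferential $\partial q(x)$, $x\in\operatorname{dom}q$, is the set of limits of $v^k\in\hat\partial q(x^k)$ with $x^k\to x$, $q(x^k)\to q(x)$. A point $x$ is stationary for $q$ if $0\in\hat\partial q(x)$. The function $q$ has the Kurdyka–Łojasiewicz (KL) property with exponent $\theta\in(0,1)$ if for every $\bar w$ with $\partial q(\bar w)\neq\emptyset$ there are $\varepsilon,\eta,\varrho>0$ such that, with $\psi(s)=\varrho s^{1-\theta}$, $\psi'(q(w)-q(\bar w))\operatorname{dist}(0,\partial q(w))\ge1$ for all $w$ with $\|w-\bar w\|<\varepsilon$ and $q(\bar w)<q(w)<q(\bar w)+\eta$ (where $\operatorname{dist}(0,\emptyset)=\infty$). *Assumptions.* (a) Each $f_i$ is $L_i$-smooth relative to the Legendre kernel $h_i$; $g$ is proper and lsc; $\varphi$ attains its minimum over $\overline C$; the stepsizes satisfy $\gamma_i\in(0,N/L_i)$ (with $N/0=\infty$); and for every $s\in\mathbb R^n$ $$T(s)=\operatorname*{argmin}_{w\in\mathbb R^n}\Big\{g(w)+\sum_{i=1}^N\tfrac1{\gamma_i}h_i(w)-\langle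 s,w\rangle\Big\}\subseteq C.$$ (b) $f_i,h_i\in C^2(\mathbb R^n)$ (hence $C=\mathbb R^n$) with $\nabla^2h_i(x)\succ0$ for all $x$ and $i$. (c) $\varphi$ has the KL property with exponent $\theta\in(0,1)$ and all its sublevel sets are bounded. (d) $g$ is convex. *Algorithm.* Given $x^{\rm init}\in C$, set $s_i^0=\frac1{\gamma_i}\nabla h_i(x^{\rm init})-\frac1N\nabla f_i(x^{\rm init})$ and $\tilde s^0=\sum_i s_i^0$. For $k=0,1,\dots$: choose any $z^k\in T(\tilde s^k)$ and $\mathcal I^{k+1}\subseteq[N]$; set $s_i^{k+1}=\frac1{\gamma_i}\nabla h_i(z^k)-\frac1N\nabla f_i(z^k)$ if $i\in\mathcal I^{k+1}$ and $s_i^{k+1}=s_i^k$ otherwise; set $\tilde s^{k+1}=\tilde s^k+\sum_{i\in\mathcal I^{k+1}}(s_i^{k+1}-s_i^k)$. The index sets follow an essentially cyclic rule: there is $T>0$ with $\bigcup_{t=1}^T\mathcal I^{k+t}=[N]$ for all $k\in\mathbb N$. *Conclusion.* For any sequences so generated, $\varphi(z^k)<\infty$ for all $k$, and there is a stationary point $z^\star$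 of $\varphi$ such that: 1. $z^k\to z^\star$; 2. if $\theta>\frac12$, there is $c>0$ with $\varphi(z^k)-\varphi(z^\star)\le c\,k^{-\frac1{2\theta-1}}$ for all $k\ge1$; 3. if $\theta\le\frac12$, then $z^k\to z^\star$ and $\varphi(z^k)\to\varphi(z^\star)$ at $R$-linear rate, i.e. there are $\rho>0$ and $c\in(0,1)$ with $\|z^k-z^\star\|\le\rho c^k$ for all $k$, and likewise (with possibly different $\rho,c$) $|\varphi(z^k)-\varphi(z^\star)|\le\rho c^k$ for all $k$. -/

import Mathlib

open Set Filter Topology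

noncomputable section

namespace BFinito

/-- `ℝⁿ` with the Euclidean norm and inner product. -/
abbrev Rn (n : ℕ) : Type := EuclideanSpace ℝ (Fin n)

/-! ### Extended-real-valued functions

A function `ℝⁿ → ℝ ∪ {∞}` is a function with values in `EReal` that never takes the value `⊥`. -/

/-- The (effective) domain `{x | h x < ∞}`. -/
def dom {n : ℕ} (h : Rn n → EReal) : Set (Rn n) := {x | h x < ⊤}

/-- The real-valued function agreeing with `h` wherever `h` is finite. -/
def realPart {n : ℕ} (h : Rn n → EReal) : Rn n → ℝ := fun x => (h x).toReal

/-- Values in `ℝ ∪ {∞}`, not identically `∞`. -/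
def IsProper {n : ℕ} (h : Rn n → EReal) : Prop := (∀ x, h x ≠ ⊥) ∧ (dom h).Nonempty

/-- Convexity of a function with values in `ℝ ∪ {∞}`
(`ConvexOn` includes the convexity of the domain). -/
def IsConvexFun {n : ℕ} (h : Rn n → EReal) : Prop := ConvexOn ℝ (dom h) (realPart h)

/-- Strict convexity of a function with values in `ℝ ∪ {∞}`. -/
def IsStrictlyConvexFun {n : ℕ} (h : Rn n → EReal) : Prop :=
  StrictConvexOn ℝ (dom h) (realPart h)

/-- `h` is real-valued and twice continuously differentiable on `ℝⁿ`. -/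
def IsC2 {n : ℕ} (h : Rn n → EReal) : Prop :=
  ∃ H : Rn n → ℝ, ContDiff ℝ 2 H ∧ ∀ x, h x = (H x : EReal)

/-- All sublevel sets `{x | h x ≤ α}`, `α ∈ ℝ`, are bounded. -/
def LevelBounded {n : ℕ} (h : Rn n → EReal) : Prop :=
  ∀ α : ℝ, Bornology.IsBounded {x | h x ≤ (α : EReal)}

/-- The set of minimizers of `ψ` over `S` (empty if `ψ` is identically `∞` on `S`). -/
def argminOn {n : ℕ} (S : Set (Rn n)) (ψ : Rn n → EReal) : Set (Rn n) :=
  {x | x ∈ S ∧ ψ x < ⊤ ∧ ∀ y ∈ S, ψ x ≤ ψ y}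

/-- The regular subdifferential: `v ∈ ∂̂h(x)` iff `h x` is finite and
`liminf_{y → x, y ≠ x} (h y - h x - ⟨v, y - x⟩) / ‖y - x‖ ≥ 0`. -/
def regularSubdiff {n : ℕ} (h : Rn n → EReal) (x : Rn n) : Set (Rn n) :=
  {v | h x ≠ ⊥ ∧ h x ≠ ⊤ ∧
    0 ≤ liminf (fun y => (h y - h x - ((inner ℝ v (y - x) : ℝ) : EReal)) /
      ((‖y - x‖ : ℝ) : EReal)) (𝓝[≠] x)}

/-- The limiting subdifferential. -/
def limitingSubdiff {n : ℕ} (h : Rn n → EReal) (x : Rn n) : Set (Rn n) :=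
  {v | x ∈ dom h ∧ ∃ (xs vs : ℕ → Rn n),
    (∀ k, vs k ∈ regularSubdiff h (xs k)) ∧
    Tendsto xs atTop (𝓝 x) ∧ Tendsto (fun k => h (xs k)) atTop (𝓝 (h x)) ∧
    Tendsto vs atTop (𝓝 v)}

/-- `x` is stationary for `h` if `0 ∈ ∂̂h(x)`. -/
def IsStationary {n : ℕ} (h : Rn n → EReal) (x : Rn n) : Prop := 0 ∈ regularSubdiff h x

/-- The Kurdyka-Łojasiewicz property with exponent `θ`: around every `w₀ ∈ dom ∂q`,
`ψ'(q w - q w₀) * dist(0, ∂q(w)) ≥ 1` with `ψ(s) = ϱ s ^ (1 - θ)`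
(the distance to the empty set being `∞`). -/
def HasKL {n : ℕ} (q : Rn n → EReal) (θ : ℝ) : Prop :=
  ∀ w₀ : Rn n, (limitingSubdiff q w₀).Nonempty →
    ∃ ε > (0 : ℝ), ∃ η > (0 : ℝ), ∃ ϱ > (0 : ℝ), ∀ w : Rn n,
      ‖w - w₀‖ < ε → q w₀ < q w → q w < q w₀ + (η : EReal) →
        1 ≤ ENNReal.ofReal
              (deriv (fun s : ℝ => ϱ * s ^ (1 - θ)) ((q w).toReal - (q w₀).toReal)) *
            Metric.infEDist 0 (limitingSubdiff q w)

/-- Legendre kernels: proper, lsc, strictly convex functions, continuously differentiable on the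
nonempty interior of their domain, `1`-coercive and essentially smooth. -/
structure IsLegendreKernel {n : ℕ} (h : Rn n → EReal) : Prop where
  proper : IsProper h
  lsc : LowerSemicontinuous h
  strictly_convex : IsStrictlyConvexFun h
  interior_nonempty : (interior (dom h)).Nonempty
  contDiffOn : ContDiffOn ℝ 1 (realPart h) (interior (dom h))
  coercive : Tendsto (fun x => h x / ((‖x‖ : ℝ) : EReal)) (Bornology.cobounded (Rn n)) (𝓝 ⊤)
  essentially_smooth : ∀ (xs : ℕ → Rn n) (x : Rn n), (∀ k, xs k ∈ interior (dom h)) →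
    x ∈ frontier (dom h) → Tendsto xs atTop (𝓝 x) →
      Tendsto (fun k => ‖gradient (realPart h) (xs k)‖) atTop atTop

/-- `f` is `L`-smooth relative to the Legendre kernel `h`. -/
structure IsRelSmooth {n : ℕ} (f h : Rn n → EReal) (L : ℝ) : Prop where
  proper : IsProper f
  lsc : LowerSemicontinuous f
  legendre : IsLegendreKernel h
  dom_subset : dom h ⊆ dom f
  nonneg : 0 ≤ L
  convex_add : ConvexOn ℝ (interior (dom h)) (fun x => L * realPart h x + realPart f x)
  convex_sub : ConvexOn ℝ (interior (dom h)) (fun x => L * realPart h x - realPart f x)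

/-! ### The finite sum problem and the Bregman Finito/MISO algorithm -/

/-- The cost `φ = (1/N) ∑ᵢ fᵢ + g`. -/
def cost {n N : ℕ} (f : Fin N → Rn n → EReal) (g : Rn n → EReal) : Rn n → EReal :=
  fun x => ((1 / (N : ℝ) : ℝ) : EReal) * ∑ i, f i x + g x

/-- `C = ⋂ᵢ int dom hᵢ`. -/
def domC {n N : ℕ} (h : Fin N → Rn n → EReal) : Set (Rn n) := ⋂ i, interior (dom (h i))

/-- `T(s) = argmin_w { g(w) + ∑ᵢ (1/γᵢ) hᵢ(w) - ⟨s, w⟩ }`. -/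
def innerProx {n N : ℕ} (h : Fin N → Rn n → EReal) (g : Rn n → EReal) (γ : Fin N → ℝ)
    (s : Rn n) : Set (Rn n) :=
  argminOn univ fun w =>
    g w + ∑ i, ((1 / γ i : ℝ) : EReal) * h i w - ((inner ℝ s w : ℝ) : EReal)

/-- The basic requirements. `γ i * L i < N` is `γᵢ < N / Lᵢ`, with `N / 0 = ∞`. -/
structure BasicAssumption {n N : ℕ} (f h : Fin N → Rn n → EReal) (g : Rn n → EReal)
    (L γ : Fin N → ℝ) : Prop where
  rel_smooth : ∀ i, IsRelSmooth (f i) (h i) (L i)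
  g_proper : IsProper g
  g_lsc : LowerSemicontinuous g
  solution_exists : (argminOn (closure (domC h)) (cost f g)).Nonempty
  stepsize : ∀ i, 0 < γ i ∧ γ i * L i < (N : ℝ)
  range_subset : ∀ s, innerProx h g γ s ⊆ domC h

/-- `(1/γᵢ) ∇hᵢ(x) - (1/N) ∇fᵢ(x)`. -/
def tableEntry {n N : ℕ} (f h : Fin N → Rn n → EReal) (γ : Fin N → ℝ) (i : Fin N)
    (x : Rn n) : Rn n :=
  (1 / γ i) • gradient (realPart (h i)) x - (1 / (N : ℝ)) • gradient (realPart (f i)) x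

/-- The sequences `z k`, `s k = (s₁ᵏ, …, s_Nᵏ)`, `st k = s̃ᵏ` are generated by the Bregman
Finito/MISO algorithm from the initial point `xinit`, with sampled index sets `I (k + 1)`. -/
structure IsBFinitoRun {n N : ℕ} (f h : Fin N → Rn n → EReal) (g : Rn n → EReal)
    (γ : Fin N → ℝ) (xinit : Rn n) (I : ℕ → Finset (Fin N))
    (z : ℕ → Rn n) (s : ℕ → Fin N → Rn n) (st : ℕ → Rn n) : Prop where
  init_mem : xinit ∈ domC h
  s_zero : ∀ i, s 0 i = tableEntry f h γ i xinit
  st_zero : st 0 = ∑ i, s 0 i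
  z_step : ∀ k, z k ∈ innerProx h g γ (st k)
  s_step : ∀ k i, s (k + 1) i = if i ∈ I (k + 1) then tableEntry f h γ i (z k) else s k i
  st_step : ∀ k, st (k + 1) = st k + ∑ i ∈ I (k + 1), (s (k + 1) i - s k i)

/-- The essentially cyclic rule: for some `T > 0`, `I^{k+1} ∪ ⋯ ∪ I^{k+T} = [N]` for all `k`. -/
def EssentiallyCyclic {N : ℕ} (I : ℕ → Finset (Fin N)) : Prop :=
  ∃ T : ℕ, 0 < T ∧ ∀ k : ℕ, (Finset.Icc 1 T).biUnion (fun t => I (k + t)) = Finset.univ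

/-- Convergence of `x` to `l` at `R`-linear rate. -/
def RLinear {E : Type*} [SeminormedAddCommGroup E] (x : ℕ → E) (l : E) : Prop :=
  ∃ c ∈ Ioo (0 : ℝ) 1, ∃ ρ > (0 : ℝ), ∀ k, ‖x k - l‖ ≤ ρ * c ^ k

end BFinito

end

/-!
The argument works with `Pᵢ = hᵢ / γᵢ - fᵢ / N`, which is convex because `γᵢ < N / Lᵢ`, and with the
points `xᵢᵏ` at which the table entries were last evaluated, so that `s̃ᵏ = ∑ᵢ ∇Pᵢ(xᵢᵏ)`. Up to a
constant, the inner problem then minimizes the model `φ + ∑ᵢ D_{Pᵢ}(·, xᵢᵏ)`, where `D` denotes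
Bregman distances. Its optimal value `Vₖ = φ(zᵏ) + ∑ᵢ D_{Pᵢ}(zᵏ, xᵢᵏ)` is the Lyapunov function.

* *Decrease.* Refreshing entries at `zᵏ` only lowers the model at `zᵏ`, and convexity of `g` gives
  the model the growth `∑ᵢ D_{hᵢ}(·, zᵏ⁺¹) / γᵢ` around its minimizer
  (`model_le_of_mem_innerProx`). As the iterates stay in a bounded set, where the `hᵢ` are strongly
  convex (`exists_bregman_lower_bound`), `Vₖ - Vₖ₊₁ ≥ a ‖zᵏ⁺¹ - zᵏ‖²`.
* *Gap and subgradients.* With period `T`, every `xᵢᵏ` with `k ≥ T` is one of the last `T`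
  iterates (`exists_table_eq`). Hence `Vₖ - φ(zᵏ)` is at most a multiple of `S²`, and `φ` has a
  subgradient at `zᵏ` of norm at most a multiple of `S`, where `S` is the length of the path through
  these iterates (`exists_bregman_upper_bound`, `neg_mem_regularSubdiff_of_forall_le`).
* *Kurdyka–Łojasiewicz inequality.* It is needed for `φ` only, with one constant along the whole
  sequence (`HasKL.exists_eventually_rpow_le`). Since the gap is quadratic in `S`, it yields for
  `δ = V - lim V` the recursion `δ (m + T) ^ (2 τ) ≤ C (δ m - δ (m + T))` for large `m`, where
  `τ = max θ (1 / 2)` (`exists_rpow_sub_le_mul_sub`).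
* *Rates.* For `τ = 1 / 2` the recursion is a contraction, so that `δ` and the step lengths decay
  geometrically. For `τ > 1 / 2` it forces the sublinear rate, which in turn makes the step lengths
  summable (`exists_le_mul_rpow_of_delayed_rpow_le_sub`, `summable_of_sq_le_sub_of_le_rpow`).
* *Stationarity.* Passing to the limit in the optimality of `zᵏ` shows that a cluster point `w`
  minimizes `φ + ∑ᵢ D_{Pᵢ}(·, w)`, whose smooth part has zero gradient at `w`
  (`exists_tendsto_stationary_and_rates`).
-/

namespace BFinito

variable {n : ℕ}

/-! ### Bregman distances of `C²` functions -/

/-- The Bregman distance `F w - F x - ⟨∇F x, w - x⟩` generated by a real-valued function `F`. -/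
noncomputable def bregman {n : ℕ} (F : Rn n → ℝ) (w x : Rn n) : ℝ :=
  F w - F x - inner ℝ (gradient F x) (w - x)

@[simp]
theorem bregman_self (F : Rn n → ℝ) (x : Rn n) : bregman F x x = 0 := by simp [bregman]

theorem bregman_eq_fderiv (F : Rn n → ℝ) (w x : Rn n) :
    bregman F w x = F w - F x - fderiv ℝ F x (w - x) := by
  rw [bregman, inner_gradient_left]

/-- First-order optimality for the sum of a convex function and a differentiable one: the convex
part lies above the affine function of slope `-∇Q z` through its value at the minimizer `z`. -/
theorem zero_le_sub_add_inner_of_isMinOn {G Q : Rn n → ℝ} {S : Set (Rn n)} (hG : ConvexOn ℝ S G)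
    {z w q : Rn n} (hz : z ∈ S) (hw : w ∈ S) (hQ : HasGradientAt Q q z)
    (hmin : ∀ y ∈ S, G z + Q z ≤ G y + Q y) : 0 ≤ G w - G z + inner ℝ q (w - z) := by
  have hline : HasDerivAt (fun t : ℝ => z + t • (w - z)) (w - z) 0 := by
    simpa using ((hasDerivAt_id (0 : ℝ)).smul_const (w - z)).const_add z
  have hQ' : HasFDerivAt Q (InnerProductSpace.toDual ℝ (Rn n) q) (z + (0 : ℝ) • (w - z)) := by
    simpa using hQ.hasFDerivAt
  have hd : HasDerivAt (fun t : ℝ => Q (z + t • (w - z))) (inner ℝ q (w - z)) 0 := by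
    simpa [Function.comp_def] using hQ'.comp_hasDerivAt 0 hline
  have hlim := hd.tendsto_slope_zero_right
  simp only [zero_add, zero_smul, add_zero, smul_eq_mul] at hlim
  have hlim' := (tendsto_const_nhds (x := G w - G z)).add hlim
  refine ge_of_tendsto hlim' ?_
  filter_upwards [Ioo_mem_nhdsGT (zero_lt_one' ℝ)] with t ht
  have hseg : (1 - t) • z + t • w = z + t • (w - z) := by module
  have hmem : z + t • (w - z) ∈ S :=
    hseg ▸ hG.1 hz hw (by linarith [ht.2]) ht.1.le (by ring)
  have hcv := hG.2 hz hw (by linarith [ht.2] : 0 ≤ 1 - t) ht.1.le (by ring)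
  rw [hseg, smul_eq_mul, smul_eq_mul] at hcv
  have hm := hmin _ hmem
  have : 0 ≤ t * (G w - G z) + (Q (z + t • (w - z)) - Q z) := by linarith
  have h2 : G w - G z + t⁻¹ * (Q (z + t • (w - z)) - Q z)
      = t⁻¹ * (t * (G w - G z) + (Q (z + t • (w - z)) - Q z)) := by
    have := ht.1.ne'
    field_simp
  rw [h2]
  exact mul_nonneg (inv_nonneg.2 ht.1.le) this

theorem bregman_nonneg {F : Rn n → ℝ} (hF : ConvexOn ℝ univ F) (hd : Differentiable ℝ F)
    (w x : Rn n) : 0 ≤ bregman F w x := by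
  have h := zero_le_sub_add_inner_of_isMinOn (Q := fun y => -F y) (q := -gradient F x) hF
    (mem_univ x) (mem_univ w)
    (by
      rw [hasGradientAt_iff_hasFDerivAt, map_neg]
      exact (hd x).hasGradientAt.hasFDerivAt.neg) (by simp)
  rw [inner_neg_left] at h
  rw [bregman]
  linarith

/-- A `C²` function has a Lipschitz gradient on bounded sets, hence a Bregman distance that grows
at most quadratically there. -/
theorem exists_bregman_upper_bound {F : Rn n → ℝ} (hF : ContDiff ℝ 2 F) (R : ℝ) :
    ∃ b : ℝ, 0 ≤ b ∧ ∀ w ∈ Metric.closedBall (0 : Rn n) R, ∀ x ∈ Metric.closedBall (0 : Rn n) R,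
      ‖gradient F w - gradient F x‖ ≤ b * ‖w - x‖ ∧ bregman F w x ≤ b * ‖w - x‖ ^ 2 := by
  have hF' : ContDiff ℝ 1 (fderiv ℝ F) := hF.fderiv_right (by norm_num)
  obtain ⟨K, hK⟩ := (hF'.contDiffOn (s := Metric.closedBall (0 : Rn n) R)).exists_lipschitzOnWith
    (by norm_num) (convex_closedBall _ _) (isCompact_closedBall _ _)
  refine ⟨K, K.2, fun w hw x hx => ⟨?_, ?_⟩⟩
  · have h := hK.norm_sub_le hw hx
    rwa [← toDual_gradient, ← toDual_gradient, ← map_sub, LinearIsometryEquiv.norm_map] at h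
  · have hsub : segment ℝ x w ⊆ Metric.closedBall (0 : Rn n) R :=
      (convex_closedBall _ _).segment_subset hx hw
    have h := (convex_segment x w).norm_image_sub_le_of_norm_fderiv_le' (f := F)
      (φ := fderiv ℝ F x) (C := K * ‖w - x‖)
      (fun y _ => (hF.differentiable (by norm_num)) y)
      (fun y hy => (hK.norm_sub_le (hsub hy) hx).trans
        (mul_le_mul_of_nonneg_left (norm_sub_le_of_mem_segment hy) K.2))
      (left_mem_segment ℝ x w) (right_mem_segment ℝ x w)
    rw [bregman_eq_fderiv]
    calc _ ≤ _ := Real.le_norm_self _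
      _ ≤ _ := h
      _ = _ := by ring

/-- A `C²` function with positive definite Hessian is strongly convex on bounded sets. -/
theorem exists_bregman_lower_bound {F : Rn n → ℝ} (hF : ContDiff ℝ 2 F)
    (hpos : ∀ x v, v ≠ 0 → 0 < fderiv ℝ (fderiv ℝ F) x v v) (R : ℝ) :
    ∃ a : ℝ, 0 < a ∧ ∀ w ∈ Metric.closedBall (0 : Rn n) R, ∀ x ∈ Metric.closedBall (0 : Rn n) R,
      a * ‖w - x‖ ^ 2 ≤ bregman F w x := by
  have hF' : ContDiff ℝ 1 (fderiv ℝ F) := hF.fderiv_right (by norm_num)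
  have hF'' : Continuous (fderiv ℝ (fderiv ℝ F)) := hF'.continuous_fderiv (by norm_num)
  -- The Hessian form is bounded below on the product of the ball with the unit sphere.
  obtain ⟨a, ha, hlow⟩ : ∃ a : ℝ, 0 < a ∧ ∀ x ∈ Metric.closedBall (0 : Rn n) R,
      ∀ v : Rn n, ‖v‖ = 1 → a ≤ fderiv ℝ (fderiv ℝ F) x v v := by
    have hcomp : IsCompact (Metric.closedBall (0 : Rn n) R ×ˢ Metric.sphere (0 : Rn n) 1) :=
      (isCompact_closedBall _ _).prod (isCompact_sphere _ _)
    have hcont : Continuous fun p : Rn n × Rn n => fderiv ℝ (fderiv ℝ F) p.1 p.2 p.2 :=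
      ((hF''.comp continuous_fst).clm_apply continuous_snd).clm_apply continuous_snd
    obtain ⟨a, ha, h⟩ := hcomp.exists_forall_le' (a := 0) hcont.continuousOn (by
      rintro ⟨x, v⟩ ⟨-, hv⟩
      refine hpos x v ?_
      rintro rfl
      simp at hv)
    exact ⟨a, ha, fun x hx v hv => h (x, v) ⟨hx, by simpa using hv⟩⟩
  have hlow' : ∀ x ∈ Metric.closedBall (0 : Rn n) R, ∀ v : Rn n,
      a * ‖v‖ ^ 2 ≤ fderiv ℝ (fderiv ℝ F) x v v := by
    intro x hx v
    rcases eq_or_ne v 0 with rfl | hv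
    · simp
    have h := hlow x hx (‖v‖⁻¹ • v) (by rw [norm_smul, norm_inv, norm_norm,
      inv_mul_cancel₀ (norm_ne_zero_iff.2 hv)])
    simp only [map_smul, smul_eq_mul, FunLike.coe_smul, Pi.smul_apply] at h
    have hv' : 0 < ‖v‖ := norm_pos_iff.2 hv
    have := mul_le_mul_of_nonneg_right h (sq_nonneg ‖v‖)
    calc _ ≤ _ := this
      _ = _ := by field_simp
  refine ⟨a / 2, half_pos ha, fun w hw x hx => ?_⟩
  set v := w - x with hv
  have hline : ∀ t : ℝ, HasDerivAt (fun t : ℝ => x + t • v) v t := fun t => by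
    simpa using ((hasDerivAt_id t).smul_const v).const_add x
  have hmem : ∀ t ∈ Icc (0 : ℝ) 1, x + t • v ∈ Metric.closedBall (0 : Rn n) R := by
    intro t ht
    have : (1 - t) • x + t • w = x + t • v := by rw [hv]; module
    rw [← this]
    exact convex_closedBall _ _ hx hw (by linarith [ht.2]) ht.1 (by ring)
  have hd1 : ∀ t, HasDerivAt (fun t : ℝ => F (x + t • v)) (fderiv ℝ F (x + t • v) v) t := fun t =>
    ((hF.differentiable (by norm_num)) (x + t • v)).hasFDerivAt.comp_hasDerivAt t (hline t)
  have hd2 : ∀ t, HasDerivAt (fun t : ℝ => fderiv ℝ F (x + t • v) v)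
      (fderiv ℝ (fderiv ℝ F) (x + t • v) v v) t := fun t => by
    have h := ((hF'.differentiable (by norm_num)) (x + t • v)).hasFDerivAt.comp_hasDerivAt t
      (hline t)
    simpa using h.clm_apply (hasDerivAt_const t v)
  have hgrow : ∀ t ∈ Icc (0 : ℝ) 1,
      a * ‖v‖ ^ 2 * t ≤ fderiv ℝ F (x + t • v) v - fderiv ℝ F x v := by
    intro t ht
    have h := (convex_Icc (0 : ℝ) 1).mul_sub_le_image_sub_of_le_deriv
      (f := fun t : ℝ => fderiv ℝ F (x + t • v) v) (C := a * ‖v‖ ^ 2)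
      (fun s _ => (hd2 s).continuousAt.continuousWithinAt)
      (fun s _ => (hd2 s).differentiableAt.differentiableWithinAt)
      (fun s hs => by
        rw [(hd2 s).deriv]
        exact hlow' _ (hmem s (interior_subset hs)) v) 0 (by simp) t ht ht.1
    simpa using h
  have hd3 : ∀ t, HasDerivAt
      (fun t : ℝ => F (x + t • v) - fderiv ℝ F x v * t - a * ‖v‖ ^ 2 / 2 * t ^ 2)
      (fderiv ℝ F (x + t • v) v - fderiv ℝ F x v - a * ‖v‖ ^ 2 * t) t := fun t => by
    have h := ((hd1 t).sub ((hasDerivAt_id t).const_mul (fderiv ℝ F x v))).sub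
      ((hasDerivAt_pow 2 t).const_mul (a * ‖v‖ ^ 2 / 2))
    refine h.congr_deriv ?_
    simp
    ring
  have h := monotoneOn_of_deriv_nonneg (convex_Icc (0 : ℝ) 1)
    (fun s _ => (hd3 s).continuousAt.continuousWithinAt)
    (fun s _ => (hd3 s).differentiableAt.differentiableWithinAt)
    (fun s hs => by
      rw [(hd3 s).deriv]
      linarith [hgrow s (interior_subset hs)])
    (left_mem_Icc.2 zero_le_one) (right_mem_Icc.2 zero_le_one) zero_le_one
  have hw' : x + v = w := by rw [hv]; abel
  simp only [zero_smul, add_zero, mul_zero, one_smul, mul_one, one_pow, hw'] at h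
  rw [bregman_eq_fderiv, ← hv]
  nlinarith

/-! ### Rates from recursive inequalities -/

theorem exists_le_mul_pow_of_delayed_contraction {δ : ℕ → ℝ} (hanti : Antitone δ)
    (hnn : ∀ k, 0 ≤ δ k) {T K : ℕ} (hT : 0 < T) {q : ℝ} (hq : q ∈ Ioo (0 : ℝ) 1)
    (h : ∀ m ≥ K, δ (m + T) ≤ q * δ m) :
    ∃ c ∈ Ioo (0 : ℝ) 1, ∃ ρ > (0 : ℝ), ∀ k, δ k ≤ ρ * c ^ k := by
  have hT' : (0 : ℝ) < T := by exact_mod_cast hT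
  set c : ℝ := q ^ (1 / (T : ℝ)) with hc
  have hc0 : 0 < c := Real.rpow_pos_of_pos hq.1 _
  have hc1 : c < 1 := Real.rpow_lt_one hq.1.le hq.2 (by positivity)
  have hcT : c ^ T = q := by
    rw [hc, ← Real.rpow_natCast, ← Real.rpow_mul hq.1.le, one_div_mul_cancel hT'.ne',
      Real.rpow_one]
  refine ⟨c, ⟨hc0, hc1⟩, (δ 0 + 1) / c ^ (K + T), by have := hnn 0; positivity, fun k => ?_⟩
  induction k using Nat.strong_induction_on with
  | _ k ih =>
    rcases lt_or_ge k (K + T) with hk | hk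
    · calc δ k ≤ δ 0 + 1 := by linarith [hanti (Nat.zero_le k)]
        _ = (δ 0 + 1) / c ^ (K + T) * c ^ (K + T) := by field_simp
        _ ≤ _ := by
          have := hnn 0
          exact mul_le_mul_of_nonneg_left (pow_le_pow_of_le_one hc0.le hc1.le hk.le)
            (by positivity)
    · obtain ⟨m, rfl⟩ : ∃ m, k = m + T := ⟨k - T, by omega⟩
      calc δ (m + T) ≤ q * δ m := h m (by omega)
        _ ≤ q * ((δ 0 + 1) / c ^ (K + T) * c ^ m) :=
          mul_le_mul_of_nonneg_left (ih m (by omega)) hq.1.le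
        _ = _ := by rw [pow_add c m T, hcT]; ring

/-- The discrete analogue of the decay of solutions of `y' = -y ^ (1 + α) / C`. -/
theorem exists_le_mul_rpow_of_rpow_le_sub {e : ℕ → ℝ} (hnn : ∀ k, 0 ≤ e k)
    {α C : ℝ} (hα : 0 < α) (hα1 : α ≤ 1) (hC : 0 < C)
    (h : ∀ j, e (j + 1) ^ (1 + α) ≤ C * (e j - e (j + 1))) :
    ∃ c > (0 : ℝ), ∀ j : ℕ, 1 ≤ j → e j ≤ c * (j : ℝ) ^ (-(1 / α)) := by
  set p : ℝ := 1 / α with hp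
  have hp1 : 1 ≤ p := by rw [hp, le_div_iff₀ hα]; linarith
  have hpα : p * α = 1 := by rw [hp]; field_simp
  have h2p : (0 : ℝ) < 2 ^ p := by positivity
  set c : ℝ := max (e 1 + 1) ((2 * C * 2 ^ p) ^ p) with hcdef
  have hc : 0 < c := lt_max_of_lt_left (by linarith [hnn 1])
  -- `c` is so large that one step of the recursion outweighs `(1 + 1 / j) ^ p`.
  have hcα : 2 * C * 2 ^ p ≤ c ^ α := by
    calc 2 * C * 2 ^ p = ((2 * C * 2 ^ p) ^ p) ^ α := by
          rw [← Real.rpow_mul (by positivity), hpα, Real.rpow_one]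
      _ ≤ _ := Real.rpow_le_rpow (by positivity) (le_max_right _ _) hα.le
  refine ⟨c, hc, fun j hj => ?_⟩
  induction j, hj using Nat.le_induction with
  | base => simpa using (by linarith [le_max_left (e 1 + 1) ((2 * C * 2 ^ p) ^ p)] : e 1 ≤ c)
  | succ j hj ih =>
    by_contra! hlt
    have hj0 : (1 : ℝ) ≤ j := by exact_mod_cast hj
    have hjp : (0 : ℝ) < j := by linarith
    push_cast at hlt
    set v := e (j + 1) with hv
    have hv0 : 0 < v := lt_of_le_of_lt (by positivity) hlt
    have hvα : 2 * C * 2 ^ p / (j + 1) ≤ v ^ α := by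
      calc 2 * C * 2 ^ p / (j + 1) ≤ c ^ α / (j + 1) := by gcongr
        _ = (c * ((j : ℝ) + 1) ^ (-p)) ^ α := by
          rw [Real.mul_rpow hc.le (by positivity), ← Real.rpow_mul (by positivity), neg_mul, hpα,
            Real.rpow_neg_one, div_eq_mul_inv]
        _ ≤ v ^ α := Real.rpow_le_rpow (by positivity) hlt.le hα.le
    have hconv : (1 + 1 / (j : ℝ)) ^ p ≤ 1 + 2 ^ p / j := by
      have hx1 : 1 / (j : ℝ) ≤ 1 := by rw [div_le_one hjp]; exact hj0
      have h := (convexOn_rpow hp1).2 (x := 1) (y := 2) (by simp) (by simp)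
        (sub_nonneg.2 hx1) (by positivity : 0 ≤ 1 / (j : ℝ)) (by ring)
      simp only [smul_eq_mul, Real.one_rpow, mul_one] at h
      have e1 : 1 - 1 / (j : ℝ) + 1 / j * 2 = 1 + 1 / j := by ring
      rw [e1] at h
      have : 0 < 1 / (j : ℝ) := by positivity
      calc _ ≤ _ := h
        _ ≤ 1 + 1 / (j : ℝ) * 2 ^ p := by linarith
        _ = _ := by ring
    have hstep : v * (1 + 1 / (j : ℝ)) ^ p ≤ e j := by
      have h1 := h j
      rw [← hv, Real.rpow_add hv0, Real.rpow_one] at h1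
      have h2 : 2 ^ p / (j : ℝ) ≤ v ^ α / C := by
        calc 2 ^ p / (j : ℝ) ≤ 2 * 2 ^ p / (j + 1) := by
              rw [div_le_div_iff₀ hjp (by positivity)]
              nlinarith
          _ = 2 * C * 2 ^ p / (j + 1) / C := by field_simp
          _ ≤ _ := by gcongr
      calc v * (1 + 1 / (j : ℝ)) ^ p ≤ v * (1 + v ^ α / C) :=
            mul_le_mul_of_nonneg_left (hconv.trans (by linarith)) hv0.le
        _ = v + v * v ^ α / C := by ring
        _ ≤ v + (e j - v) := by
          gcongr
          rw [div_le_iff₀ hC]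
          linarith
        _ = e j := by ring
    have hid : c * ((j : ℝ) + 1) ^ (-p) * (1 + 1 / (j : ℝ)) ^ p = c * (j : ℝ) ^ (-p) := by
      have : 1 + 1 / (j : ℝ) = (j + 1) / j := by field_simp
      rw [this, Real.div_rpow (by positivity) hjp.le, Real.rpow_neg (by positivity),
        Real.rpow_neg hjp.le]
      have : ((j : ℝ) + 1) ^ p ≠ 0 := by positivity
      field_simp
    have hfin : c * ((j : ℝ) + 1) ^ (-p) * (1 + 1 / (j : ℝ)) ^ p < v * (1 + 1 / (j : ℝ)) ^ p :=
      mul_lt_mul_of_pos_right hlt (by positivity)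
    rw [hid] at hfin
    linarith

theorem exists_le_mul_rpow_of_delayed_rpow_le_sub {δ : ℕ → ℝ} (hanti : Antitone δ)
    (hnn : ∀ k, 0 ≤ δ k) {T K : ℕ} (hT : 0 < T)
    {α C : ℝ} (hα : 0 < α) (hα1 : α ≤ 1) (hC : 0 < C)
    (h : ∀ m ≥ K, δ (m + T) ^ (1 + α) ≤ C * (δ m - δ (m + T))) :
    ∃ c > (0 : ℝ), ∀ k : ℕ, 1 ≤ k → δ k ≤ c * (k : ℝ) ^ (-(1 / α)) := by
  obtain ⟨c, hc, hcj⟩ := exists_le_mul_rpow_of_rpow_le_sub (e := fun j => δ (K + j * T))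
    (fun j => hnn _) hα hα1 hC (fun j => by
      have := h (K + j * T) (by omega)
      rwa [show K + (j + 1) * T = K + j * T + T by ring])
  set p : ℝ := 1 / α with hp
  have hp0 : 0 < p := by positivity
  have hT1 : (1 : ℝ) ≤ T := by exact_mod_cast hT
  have hA : (0 : ℝ) < K + 2 * T := by positivity
  have hδ0 := hnn 0
  refine ⟨(c + δ 0) * ((K : ℝ) + 2 * T) ^ p, by positivity, fun k hk => ?_⟩
  have hk0 : (0 : ℝ) < k := by exact_mod_cast hk
  have hrw : (c + δ 0) * ((K : ℝ) + 2 * T) ^ p * (k : ℝ) ^ (-p)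
      = (c + δ 0) * ((k : ℝ) / (K + 2 * T)) ^ (-p) := by
    rw [Real.div_rpow hk0.le hA.le, Real.rpow_neg hA.le]
    field_simp
  rw [hrw]
  rcases lt_or_ge k (K + T) with hkK | hkK
  · have hle : (k : ℝ) / (K + 2 * T) ≤ 1 := by
      rw [div_le_one hA]
      have : (k : ℝ) < K + T := by exact_mod_cast hkK
      linarith
    have h1 : 1 ≤ ((k : ℝ) / (K + 2 * T)) ^ (-p) :=
      Real.one_le_rpow_of_pos_of_le_one_of_nonpos (by positivity) hle (by linarith)
    nlinarith [hanti (Nat.zero_le k)]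
  · set j := (k - K) / T with hj
    have hj1 : 1 ≤ j := (Nat.le_div_iff_mul_le hT).2 (by omega)
    have hjle : K + j * T ≤ k := by
      have := Nat.div_mul_le_self (k - K) T
      rw [← hj] at this
      omega
    have hlt : k < K + (j + 1) * T := by
      have := Nat.lt_div_mul_add (a := k - K) hT
      rw [← hj] at this
      rw [add_mul, one_mul]
      omega
    have hj1' : (1 : ℝ) ≤ j := by exact_mod_cast hj1
    have hdiv : (k : ℝ) / (K + 2 * T) ≤ j := by
      rw [div_le_iff₀ hA]
      have : (k : ℝ) < K + (j + 1) * T := by exact_mod_cast hlt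
      have hK0 : (0 : ℝ) ≤ K := by positivity
      nlinarith
    calc δ k ≤ δ (K + j * T) := hanti hjle
      _ ≤ c * (j : ℝ) ^ (-p) := hcj j hj1
      _ ≤ c * ((k : ℝ) / (K + 2 * T)) ^ (-p) :=
        mul_le_mul_of_nonneg_left
          (Real.rpow_le_rpow_of_nonpos (by positivity) hdiv (by linarith)) hc.le
      _ ≤ _ := by
        gcongr
        linarith

/-- The step lengths are split by the concavity inequality for the desingularizing function
`s ↦ s ^ (1 - θ)`: one part telescopes, and the other, `δ k ^ θ`, is a convergent `p`-series since
`θ / (2 θ - 1) > 1`. -/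
theorem summable_of_sq_le_sub_of_le_rpow {d δ : ℕ → ℝ} (hnn : ∀ k, 0 ≤ δ k)
    (hd : ∀ k, 0 ≤ d k) {a c θ : ℝ} (ha : 0 < a) (hθ : 1 / 2 < θ) (hθ1 : θ < 1)
    (hdesc : ∀ k, a * d k ^ 2 ≤ δ k - δ (k + 1))
    (hrate : ∀ k : ℕ, 1 ≤ k → δ k ≤ c * (k : ℝ) ^ (-(1 / (2 * θ - 1)))) :
    Summable d := by
  have hc : 0 ≤ c := by simpa using (hnn 1).trans (hrate 1 le_rfl)
  have hw : Summable fun k => δ k ^ θ := by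
    have hs : Summable fun k : ℕ => c ^ θ * (k : ℝ) ^ (-(θ / (2 * θ - 1))) :=
      (Real.summable_nat_rpow.2 (by
        rw [neg_lt_neg_iff, lt_div_iff₀ (by linarith)]
        linarith)).mul_left _
    refine Summable.of_norm_bounded_eventually_nat hs ?_
    filter_upwards [eventually_ge_atTop 1] with k hk
    rw [Real.norm_of_nonneg (Real.rpow_nonneg (hnn k) _)]
    calc δ k ^ θ ≤ (c * (k : ℝ) ^ (-(1 / (2 * θ - 1)))) ^ θ :=
          Real.rpow_le_rpow (hnn k) (hrate k hk) (by linarith)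
      _ = _ := by
        rw [Real.mul_rpow hc (by positivity), ← Real.rpow_mul (by positivity)]
        congr 2
        ring
  have hA : 0 < a * (1 - θ) := mul_pos ha (by linarith)
  have hstep : ∀ k, d k ≤ (a * (1 - θ))⁻¹ * (δ k ^ (1 - θ) - δ (k + 1) ^ (1 - θ)) + δ k ^ θ := by
    intro k
    have hle : δ (k + 1) ≤ δ k := by nlinarith [hdesc k, sq_nonneg (d k)]
    have hψ : 0 ≤ δ k ^ (1 - θ) - δ (k + 1) ^ (1 - θ) :=
      sub_nonneg.2 (Real.rpow_le_rpow (hnn _) hle (by linarith))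
    rcases (hnn k).eq_or_lt with h0 | h0
    · have hdk : d k = 0 := by
        have h1 := hdesc k
        rw [← h0] at h1
        have : d k ^ 2 ≤ 0 := by
          by_contra! hcon
          nlinarith [hnn (k + 1), mul_pos ha hcon]
        exact pow_eq_zero_iff (two_ne_zero) |>.1 (le_antisymm this (sq_nonneg _))
      rw [hdk]
      exact add_nonneg (mul_nonneg (inv_nonneg.2 hA.le) hψ) (Real.rpow_nonneg (hnn k) _)
    · have hx : -1 ≤ δ (k + 1) / δ k - 1 := by
        have : 0 ≤ δ (k + 1) / δ k := div_nonneg (hnn _) (hnn _)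
        linarith
      have hb := rpow_one_add_le_one_add_mul_self hx (p := 1 - θ) (by linarith) (by linarith)
      rw [add_sub_cancel, Real.div_rpow (hnn _) h0.le, div_le_iff₀ (by positivity)] at hb
      have hsplit : δ k ^ (1 - θ) * δ k ^ θ = δ k := by
        rw [← Real.rpow_add h0]
        simp
      set w := δ k ^ θ with hwdef
      have hwpos : 0 < w := Real.rpow_pos_of_pos h0 _
      have hmul : a * (1 - θ) * d k ^ 2 ≤ (δ k ^ (1 - θ) - δ (k + 1) ^ (1 - θ)) * w := by
        have h1 : (1 - θ) * (δ k - δ (k + 1)) ≤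
            (δ k ^ (1 - θ) - δ (k + 1) ^ (1 - θ)) * w := by
          have h2 : (1 + (1 - θ) * (δ (k + 1) / δ k - 1)) * δ k ^ (1 - θ) * w =
              δ k - (1 - θ) * (δ k - δ (k + 1)) := by
            rw [mul_assoc, hsplit]
            field_simp
            ring
          nlinarith [mul_le_mul_of_nonneg_right hb hwpos.le]
        nlinarith [hdesc k]
      have h3 : d k ^ 2 ≤ (a * (1 - θ))⁻¹ * (δ k ^ (1 - θ) - δ (k + 1) ^ (1 - θ)) * w := by
        rw [mul_assoc, ← div_eq_inv_mul, le_div_iff₀ hA]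
        linarith
      set u := (a * (1 - θ))⁻¹ * (δ k ^ (1 - θ) - δ (k + 1) ^ (1 - θ)) with hu
      have hu0 : 0 ≤ u := mul_nonneg (inv_nonneg.2 hA.le) hψ
      refine abs_le_of_sq_le_sq' ?_ (by linarith) |>.2
      nlinarith
  refine summable_of_sum_range_le
    (c := (a * (1 - θ))⁻¹ * δ 0 ^ (1 - θ) + ∑' k, δ k ^ θ) hd fun m => ?_
  calc ∑ k ∈ Finset.range m, d k ≤ ∑ k ∈ Finset.range m,
        ((a * (1 - θ))⁻¹ * (δ k ^ (1 - θ) - δ (k + 1) ^ (1 - θ)) + δ k ^ θ) :=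
        Finset.sum_le_sum fun k _ => hstep k
    _ = (a * (1 - θ))⁻¹ * (δ 0 ^ (1 - θ) - δ m ^ (1 - θ)) + ∑ k ∈ Finset.range m, δ k ^ θ := by
      rw [Finset.sum_add_distrib, ← Finset.mul_sum,
        Finset.sum_range_sub' (fun k => δ k ^ (1 - θ))]
    _ ≤ _ := by
      have h1 : ∑ k ∈ Finset.range m, δ k ^ θ ≤ ∑' k, δ k ^ θ :=
        hw.sum_le_tsum _ fun k _ => Real.rpow_nonneg (hnn k) _
      have h2 := Real.rpow_nonneg (hnn m) (1 - θ)
      have h3 := inv_nonneg.2 hA.le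
      nlinarith [mul_nonneg h3 h2]

theorem RLinear.of_norm_sub_le_add {E : Type*} [SeminormedAddCommGroup E] {x : ℕ → E} {l : E}
    (T : ℕ) {c ρ : ℝ} (hc : c ∈ Ioo (0 : ℝ) 1) (hρ : 0 < ρ)
    (h : ∀ m, ‖x (m + T) - l‖ ≤ ρ * c ^ m) : RLinear x l := by
  have hc0 := hc.1
  refine ⟨c, hc, (ρ + ∑ j ∈ Finset.range T, ‖x j - l‖) / c ^ T, by positivity, fun k => ?_⟩
  have hS : 0 ≤ ∑ j ∈ Finset.range T, ‖x j - l‖ := by positivity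
  rcases lt_or_ge k T with hk | hk
  · have h1 : ‖x k - l‖ ≤ ∑ j ∈ Finset.range T, ‖x j - l‖ :=
      Finset.single_le_sum (f := fun j => ‖x j - l‖) (fun j _ => norm_nonneg _)
        (Finset.mem_range.2 hk)
    calc ‖x k - l‖ ≤ (ρ + ∑ j ∈ Finset.range T, ‖x j - l‖) / c ^ T * c ^ T := by
          rw [div_mul_cancel₀ _ (by positivity)]
          linarith
      _ ≤ _ := mul_le_mul_of_nonneg_left (pow_le_pow_of_le_one hc0.le hc.2.le hk.le)
          (by positivity)
  · obtain ⟨m, rfl⟩ : ∃ m, k = m + T := ⟨k - T, by omega⟩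
    calc _ ≤ _ := h m
      _ ≤ (ρ + ∑ j ∈ Finset.range T, ‖x j - l‖) * c ^ m := by gcongr; linarith
      _ = _ := by rw [pow_add]; field_simp

/-! ### Descent sequences with a delayed Lyapunov function -/

/-- The length of the path `z m, z (m + 1), …, z (m + T)`. -/
noncomputable def pathLength {E : Type*} [SeminormedAddCommGroup E] (z : ℕ → E) (m T : ℕ) : ℝ :=
  ∑ j ∈ Finset.range T, ‖z (m + j + 1) - z (m + j)‖

section
variable {E : Type*} [SeminormedAddCommGroup E] {z : ℕ → E}

theorem pathLength_nonneg (m T : ℕ) : 0 ≤ pathLength z m T :=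
  Finset.sum_nonneg fun _ _ => norm_nonneg _

theorem norm_sub_le_pathLength {m T j : ℕ} (hj : j ≤ T) :
    ‖z (m + T) - z (m + j)‖ ≤ pathLength z m T := by
  induction T with
  | zero =>
    obtain rfl : j = 0 := by omega
    simp [pathLength]
  | succ T ih =>
    rw [pathLength, Finset.sum_range_succ, ← pathLength]
    rcases Nat.lt_or_ge T j with h | h
    · obtain rfl : j = T + 1 := by omega
      rw [sub_self, norm_zero]
      exact add_nonneg (pathLength_nonneg _ _) (norm_nonneg _)
    · calc ‖z (m + (T + 1)) - z (m + j)‖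
          = ‖(z (m + T + 1) - z (m + T)) + (z (m + T) - z (m + j))‖ := by
            rw [sub_add_sub_cancel]; rfl
        _ ≤ _ := norm_add_le _ _
        _ ≤ _ := by rw [add_comm]; gcongr; exact ih h

theorem sq_pathLength_le {V : ℕ → ℝ} {a : ℝ} (ha : 0 < a)
    (hdesc : ∀ k, a * ‖z (k + 1) - z k‖ ^ 2 ≤ V k - V (k + 1)) (m T : ℕ) :
    pathLength z m T ^ 2 ≤ T / a * (V m - V (m + T)) := by
  have h1 : pathLength z m T ^ 2 ≤ T * ∑ j ∈ Finset.range T, ‖z (m + j + 1) - z (m + j)‖ ^ 2 := by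
    simpa [pathLength] using sq_sum_le_card_mul_sum_sq (s := Finset.range T)
      (f := fun j => ‖z (m + j + 1) - z (m + j)‖)
  have h2 : a * ∑ j ∈ Finset.range T, ‖z (m + j + 1) - z (m + j)‖ ^ 2 ≤ V m - V (m + T) := by
    rw [Finset.mul_sum]
    calc _ ≤ ∑ j ∈ Finset.range T, (V (m + j) - V (m + (j + 1))) :=
          Finset.sum_le_sum fun j _ => hdesc (m + j)
      _ = _ := by rw [Finset.sum_range_sub' (fun j => V (m + j))]; simp
  calc _ ≤ _ := h1
    _ ≤ T * ((V m - V (m + T)) / a) := by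
      gcongr
      rw [le_div_iff₀ ha]
      linarith
    _ = _ := by ring

theorem tendsto_pathLength {V : ℕ → ℝ} {a φ : ℝ} (ha : 0 < a)
    (hdesc : ∀ k, a * ‖z (k + 1) - z k‖ ^ 2 ≤ V k - V (k + 1)) (hV : Tendsto V atTop (𝓝 φ))
    (T : ℕ) : Tendsto (fun m => pathLength z m T) atTop (𝓝 0) := by
  have h1 : Tendsto (fun m => T / a * (V m - V (m + T))) atTop (𝓝 0) := by
    simpa using (hV.sub ((tendsto_add_atTop_iff_nat T).2 hV)).const_mul (T / a)
  have h2 : Tendsto (fun m => pathLength z m T ^ 2) atTop (𝓝 0) :=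
    squeeze_zero (fun m => sq_nonneg _) (fun m => sq_pathLength_le ha hdesc m T) h1
  have h3 := h2.sqrt
  simpa [Real.sqrt_sq (pathLength_nonneg _ _)] using h3

/-- The Kurdyka–Łojasiewicz inequality for the cost values `p` passes to the Lyapunov values `V`,
with the exponent `max θ (1 / 2)`, because their gap is at most quadratic in the path length; with
the sufficient decrease it becomes a recursive inequality for `V` alone. -/
theorem exists_rpow_sub_le_mul_sub {V p : ℕ → ℝ} {φ a b B θ τ : ℝ} {T : ℕ}
    (ha : 0 < a) (hb : 0 ≤ b) (hB : 0 ≤ B) (hθ : 0 < θ) (hθτ : θ ≤ τ) (hτ : 1 / 2 ≤ τ)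
    (hdesc : ∀ k, a * ‖z (k + 1) - z k‖ ^ 2 ≤ V k - V (k + 1)) (hV : Tendsto V atTop (𝓝 φ))
    (hφ : ∀ k, φ ≤ V k)
    (hgap : ∀ m, V (m + T) ≤ p (m + T) + b * pathLength z m T ^ 2)
    (hKL : ∀ᶠ m in atTop, φ < p (m + T) → (p (m + T) - φ) ^ θ ≤ B * pathLength z m T) :
    ∃ C > (0 : ℝ), ∃ K, ∀ m ≥ K,
      (V (m + T) - φ) ^ (2 * τ) ≤ C * ((V m - φ) - (V (m + T) - φ)) := by
  have hS := tendsto_pathLength ha hdesc hV T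
  have hev1 : ∀ᶠ m in atTop, B * pathLength z m T < 1 :=
    (by simpa using hS.const_mul B : Tendsto (fun m => B * pathLength z m T) atTop (𝓝 0)).eventually
      (gt_mem_nhds one_pos)
  have hev2 : ∀ᶠ m in atTop, pathLength z m T < 1 := hS.eventually (gt_mem_nhds one_pos)
  obtain ⟨K, hK⟩ := eventually_atTop.1 (hKL.and (hev1.and hev2))
  have hτ0 : 0 < τ := by linarith
  refine ⟨(B ^ (1 / τ) + b) ^ (2 * τ) * (T / a) + 1, by positivity, K, fun m hm => ?_⟩
  obtain ⟨h1, h2, h3⟩ := hK m hm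
  set S := pathLength z m T with hSdef
  have hS0 : 0 ≤ S := pathLength_nonneg m T
  have hp : p (m + T) - φ ≤ B ^ (1 / τ) * S ^ (1 / τ) := by
    rcases le_or_gt (p (m + T)) φ with h | h
    · have : 0 ≤ B ^ (1 / τ) * S ^ (1 / τ) := by positivity
      linarith
    · have hpos : 0 < p (m + T) - φ := sub_pos.2 h
      have hBS : 0 < B * S := (Real.rpow_pos_of_pos hpos θ).trans_le (h1 h)
      calc p (m + T) - φ = ((p (m + T) - φ) ^ θ) ^ (1 / θ) := by
            rw [← Real.rpow_mul hpos.le, mul_one_div_cancel hθ.ne', Real.rpow_one]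
        _ ≤ (B * S) ^ (1 / θ) := Real.rpow_le_rpow (by positivity) (h1 h) (by positivity)
        _ ≤ (B * S) ^ (1 / τ) := Real.rpow_le_rpow_of_exponent_ge hBS h2.le
            (one_div_le_one_div_of_le hθ hθτ)
        _ = _ := Real.mul_rpow hB hS0
  have hS2 : S ^ 2 ≤ S ^ (1 / τ) := by
    rcases hS0.eq_or_lt with h | h
    · rw [← h]
      simp only [ne_eq, OfNat.ofNat_ne_zero, not_false_eq_true, zero_pow]
      positivity
    · rw [← Real.rpow_natCast]
      refine Real.rpow_le_rpow_of_exponent_ge h h3.le ?_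
      rw [div_le_iff₀ hτ0]
      push_cast
      linarith
  have hδ : V (m + T) - φ ≤ (B ^ (1 / τ) + b) * S ^ (1 / τ) := by
    nlinarith [hgap m, mul_le_mul_of_nonneg_left hS2 hb]
  have hdiff : 0 ≤ V m - V (m + T) := by
    have hanti : Antitone V := antitone_nat_of_succ_le fun k => by
      nlinarith [hdesc k, sq_nonneg ‖z (k + 1) - z k‖]
    linarith [hanti (Nat.le_add_right m T)]
  have hsq := sq_pathLength_le ha hdesc m T
  rw [← hSdef] at hsq
  calc (V (m + T) - φ) ^ (2 * τ) ≤ ((B ^ (1 / τ) + b) * S ^ (1 / τ)) ^ (2 * τ) :=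
        Real.rpow_le_rpow (sub_nonneg.2 (hφ _)) hδ (by positivity)
    _ = (B ^ (1 / τ) + b) ^ (2 * τ) * S ^ 2 := by
      rw [Real.mul_rpow (by positivity) (by positivity), ← Real.rpow_mul hS0,
        show 1 / τ * (2 * τ) = ((2 : ℕ) : ℝ) by push_cast; field_simp, Real.rpow_natCast]
    _ ≤ (B ^ (1 / τ) + b) ^ (2 * τ) * (T / a * (V m - V (m + T))) := by gcongr
    _ ≤ ((B ^ (1 / τ) + b) ^ (2 * τ) * (T / a) + 1) * (V m - V (m + T)) := by
      rw [add_mul, mul_assoc]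
      linarith
    _ = _ := by ring
end

/-- Convergence and rates for a descent method with a Lyapunov function, in terms of sequences
only: `V` are the Lyapunov values and `p` the cost values along `z`, and `T` is the delay up to
which past iterates enter the Lyapunov function. -/
theorem exists_tendsto_and_rates {E : Type*} [NormedAddCommGroup E] [CompleteSpace E]
    {z : ℕ → E} {V p : ℕ → ℝ} {φ a b B θ : ℝ} {T : ℕ} (hT : 0 < T)
    (ha : 0 < a) (hb : 0 ≤ b) (hB : 0 ≤ B) (hθ : θ ∈ Ioo (0 : ℝ) 1)
    (hdesc : ∀ k, a * ‖z (k + 1) - z k‖ ^ 2 ≤ V k - V (k + 1)) (hV : Tendsto V atTop (𝓝 φ))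
    (hp : ∀ k, p k ≤ V k)
    (hgap : ∀ m, V (m + T) ≤ p (m + T) + b * pathLength z m T ^ 2)
    (hKL : ∀ᶠ m in atTop, φ < p (m + T) → (p (m + T) - φ) ^ θ ≤ B * pathLength z m T) :
    ∃ zs, Tendsto z atTop (𝓝 zs) ∧
      (1 / 2 < θ → ∃ c > (0 : ℝ), ∀ k : ℕ, 1 ≤ k →
        p k - φ ≤ c * (k : ℝ) ^ (-(1 / (2 * θ - 1)))) ∧
      (θ ≤ 1 / 2 → RLinear z zs ∧ RLinear p φ) := by
  have hanti : Antitone V := antitone_nat_of_succ_le fun k => by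
    nlinarith [hdesc k, sq_nonneg ‖z (k + 1) - z k‖]
  have hφ : ∀ k, φ ≤ V k := fun k => hanti.le_of_tendsto hV k
  have hanti' : Antitone fun k => V k - φ := fun i j hij => sub_le_sub_right (hanti hij) φ
  have hnn : ∀ k, 0 ≤ V k - φ := fun k => sub_nonneg.2 (hφ k)
  rcases lt_or_ge (1 / 2) θ with h | h
  · obtain ⟨C, hC, K, hK⟩ :=
      exists_rpow_sub_le_mul_sub ha hb hB hθ.1 le_rfl h.le hdesc hV hφ hgap hKL
    obtain ⟨c, hc, hrate⟩ := exists_le_mul_rpow_of_delayed_rpow_le_sub hanti' hnn hT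
      (α := 2 * θ - 1) (by linarith) (by linarith [hθ.2]) hC (K := K)
      (fun m hm => by simpa using hK m hm)
    have hsum := summable_of_sq_le_sub_of_le_rpow hnn (d := fun k => ‖z (k + 1) - z k‖)
      (fun k => norm_nonneg _) ha h hθ.2 (fun k => by linarith [hdesc k]) hrate
    obtain ⟨zs, hzs⟩ := cauchySeq_tendsto_of_complete
      (cauchySeq_of_summable_dist (f := z) (by
        simpa only [dist_eq_norm, norm_sub_rev] using hsum))
    exact ⟨zs, hzs, fun _ => ⟨c, hc, fun k hk => by linarith [hrate k hk, hp k]⟩,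
      fun h' => absurd h (not_lt.2 h')⟩
  · obtain ⟨C, hC, K, hK⟩ :=
      exists_rpow_sub_le_mul_sub ha hb hB hθ.1 h le_rfl hdesc hV hφ hgap hKL
    obtain ⟨c, hc, ρ, hρ, hrate⟩ := exists_le_mul_pow_of_delayed_contraction hanti' hnn hT
      (q := C / (1 + C)) (K := K) ⟨by positivity, by rw [div_lt_one (by positivity)]; linarith⟩
      (fun m hm => by
        have := hK m hm
        simp only [mul_one_div_cancel (two_ne_zero' ℝ), Real.rpow_one] at this
        rw [div_mul_eq_mul_div, le_div_iff₀ (by positivity)]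
        linarith)
    have hc0 : 0 < c := hc.1
    have hr1 : √c < 1 := by
      rw [Real.sqrt_lt' one_pos]
      simpa using hc.2
    have hstep : ∀ k, dist (z k) (z (k + 1)) ≤ √(ρ / a) * √c ^ k := by
      intro k
      rw [dist_eq_norm, norm_sub_rev]
      refine (sq_le_sq₀ (norm_nonneg _) (by positivity)).1 ?_
      rw [mul_pow, ← pow_mul, mul_comm k 2, pow_mul, Real.sq_sqrt (by positivity),
        Real.sq_sqrt hc0.le, div_mul_eq_mul_div, le_div_iff₀ ha]
      linarith [hdesc k, hrate k, hnn (k + 1)]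
    obtain ⟨zs, hzs⟩ := cauchySeq_tendsto_of_complete (cauchySeq_of_le_geometric _ _ hr1 hstep)
    refine ⟨zs, hzs, fun h' => absurd h (not_le.2 h'), fun _ => ⟨?_, ?_⟩⟩
    · have h1r : 0 < 1 - √c := by linarith
      refine ⟨√c, ⟨by positivity, hr1⟩, √(ρ / a) / (1 - √c), by positivity, fun k => ?_⟩
      have := dist_le_of_le_geometric_of_tendsto _ _ hr1 hstep hzs k
      rw [dist_eq_norm] at this
      calc _ ≤ _ := this
        _ = _ := by ring
    · refine RLinear.of_norm_sub_le_add T hc (ρ := (1 + b * (T / a)) * ρ) (by positivity)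
        fun m => ?_
      have h1 : pathLength z m T ^ 2 ≤ T / a * (V m - φ) :=
        (sq_pathLength_le ha hdesc m T).trans
          (mul_le_mul_of_nonneg_left (by linarith [hφ (m + T)]) (by positivity))
      have h2 := mul_le_mul_of_nonneg_left h1 hb
      have h3 := hanti' (Nat.le_add_right m T)
      have h4 : 0 ≤ b * (T / a) := by positivity
      simp only at h3
      calc ‖p (m + T) - φ‖ ≤ (1 + b * (T / a)) * (V m - φ) := by
            rw [Real.norm_eq_abs, abs_le]
            constructor
            · nlinarith [hgap m, hφ (m + T), hnn m]
            · nlinarith [hp (m + T), mul_nonneg h4 (hnn m)]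
        _ ≤ (1 + b * (T / a)) * (ρ * c ^ m) := by gcongr; exact hrate m
        _ = _ := by ring

/-! ### Subdifferentials and the Kurdyka–Łojasiewicz inequality -/

theorem regularSubdiff_subset_limitingSubdiff (q : Rn n → EReal) (x : Rn n) :
    regularSubdiff q x ⊆ limitingSubdiff q x := fun v hv =>
  ⟨lt_top_iff_ne_top.2 hv.2.1, fun _ => x, fun _ => v, fun _ => hv, tendsto_const_nhds,
    tendsto_const_nhds, tendsto_const_nhds⟩

/-- Fermat's rule for the sum of `q` and a differentiable function. -/
theorem neg_mem_regularSubdiff_of_forall_le {q : Rn n → EReal} {Q : Rn n → ℝ} {x u : Rn n} {r : ℝ}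
    (hr : q x = r) (hQ : HasGradientAt Q u x)
    (hmin : ∀ w, ((r + Q x : ℝ) : EReal) ≤ q w + (Q w : EReal)) : -u ∈ regularSubdiff q x := by
  refine ⟨by simp [hr], by simp [hr], le_of_forall_lt fun c hc => ?_⟩
  obtain ⟨e, hce, he⟩ := EReal.lt_iff_exists_real_btwn.1 hc
  have he' : e < 0 := by exact_mod_cast he
  refine hce.trans_le (le_liminf_of_le (by isBoundedDefault) ?_)
  have hlo := (hasGradientAt_iff_isLittleO.1 hQ).def (neg_pos.2 he')
  filter_upwards [nhdsWithin_le_nhds hlo, self_mem_nhdsWithin] with y hy hyx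
  have hpos : 0 < ‖y - x‖ := norm_pos_iff.2 (sub_ne_zero.2 hyx)
  have hm := hmin y
  rw [hr]
  induction hqy : q y with
  | bot =>
    rw [hqy, EReal.bot_add] at hm
    exact absurd hm (not_le.2 (EReal.bot_lt_coe _))
  | top =>
    rw [EReal.top_sub_coe, EReal.top_sub_coe,
      EReal.top_div_of_pos_ne_top (by exact_mod_cast hpos) (EReal.coe_ne_top _)]
    exact le_top
  | coe s =>
    rw [hqy] at hm
    norm_cast at hm ⊢
    rw [← EReal.coe_div, EReal.coe_le_coe_iff, le_div_iff₀ hpos, inner_neg_left]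
    have := (Real.le_norm_self _).trans hy
    linarith

/-- The Kurdyka–Łojasiewicz inequality at `w₀`, solved for the gap in the values. -/
theorem HasKL.exists_rpow_le {q : Rn n → EReal} {θ : ℝ} (hKL : HasKL q θ)
    (hθ : θ ∈ Ioo (0 : ℝ) 1) {w₀ : Rn n} {r₀ : ℝ} (hr₀ : q w₀ = r₀)
    (hne : (limitingSubdiff q w₀).Nonempty) :
    ∃ ε > (0 : ℝ), ∃ η > (0 : ℝ), ∃ B ≥ (0 : ℝ), ∀ (w v : Rn n) (r : ℝ), ‖w - w₀‖ < ε →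
      v ∈ regularSubdiff q w → q w = r → r₀ < r → r < r₀ + η → (r - r₀) ^ θ ≤ B * ‖v‖ := by
  obtain ⟨ε, hε, η, hη, ϱ, hϱ, h⟩ := hKL w₀ hne
  refine ⟨ε, hε, η, hη, ϱ * (1 - θ), mul_nonneg hϱ.le (by linarith [hθ.2]), ?_⟩
  intro w v r hw hv hr h1 h2
  have hs : 0 < r - r₀ := sub_pos.2 h1
  have h3 := h w hw (by rw [hr, hr₀]; exact_mod_cast h1) (by rw [hr, hr₀]; exact_mod_cast h2)
  have hderiv : deriv (fun s : ℝ => ϱ * s ^ (1 - θ)) (r - r₀) =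
      ϱ * (1 - θ) * (r - r₀) ^ (-θ) := by
    have := ((Real.hasDerivAt_rpow_const (p := 1 - θ) (Or.inl hs.ne')).const_mul ϱ).deriv
    rw [this, show 1 - θ - 1 = -θ by ring]
    ring
  have hdist : Metric.infEDist 0 (limitingSubdiff q w) ≤ ENNReal.ofReal ‖v‖ := by
    refine (Metric.infEDist_le_edist_of_mem
      (regularSubdiff_subset_limitingSubdiff q w hv)).trans_eq ?_
    rw [edist_dist, dist_zero_left]
  have h1θ : 0 < 1 - θ := by linarith [hθ.2]
  rw [hr, hr₀, EReal.toReal_coe, EReal.toReal_coe, hderiv] at h3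
  have h4 := h3.trans (mul_le_mul_right hdist _)
  rw [← ENNReal.ofReal_mul (by positivity), ENNReal.one_le_ofReal] at h4
  have h5 := mul_le_mul_of_nonneg_right h4 (Real.rpow_nonneg hs.le θ)
  rw [one_mul] at h5
  have h6 : (r - r₀) ^ (-θ) * (r - r₀) ^ θ = 1 := by
    rw [← Real.rpow_add hs]
    simp
  calc _ ≤ _ := h5
    _ = ϱ * (1 - θ) * ‖v‖ * ((r - r₀) ^ (-θ) * (r - r₀) ^ θ) := by ring
    _ = _ := by rw [h6, mul_one]

/-- The Kurdyka–Łojasiewicz inequality holds with one constant along a sequence in a compact set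
whose cluster points all have the limit value: a point of the compact set either is a cluster
point, or is not approached by the sequence, so finitely many neighbourhoods suffice. -/
theorem HasKL.exists_eventually_rpow_le {q : Rn n → EReal} {θ : ℝ} (hKL : HasKL q θ)
    (hθ : θ ∈ Ioo (0 : ℝ) 1) {z v : ℕ → Rn n} {p : ℕ → ℝ} {φ : ℝ} {K : Set (Rn n)}
    (hK : IsCompact K) (hz : ∀ k, z k ∈ K) (hqz : ∀ k, q (z k) = p k)
    (hv : ∀ k, v k ∈ regularSubdiff q (z k)) (hp : Tendsto p atTop (𝓝 φ))
    (hcl : ∀ w, MapClusterPt w atTop z → q w = φ ∧ (limitingSubdiff q w).Nonempty) :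
    ∃ B ≥ (0 : ℝ), ∀ᶠ k in atTop, φ < p k → (p k - φ) ^ θ ≤ B * ‖v k‖ := by
  suffices h : ∃ B ≥ (0 : ℝ), ∀ᶠ k in atTop, z k ∈ K → φ < p k → (p k - φ) ^ θ ≤ B * ‖v k‖ by
    obtain ⟨B, hB, h⟩ := h
    exact ⟨B, hB, h.mono fun k hk => hk (hz k)⟩
  refine hK.induction_on (p := fun S => ∃ B ≥ (0 : ℝ), ∀ᶠ k in atTop, z k ∈ S → φ < p k →
    (p k - φ) ^ θ ≤ B * ‖v k‖) ?_ ?_ ?_ ?_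
  · exact ⟨0, le_rfl, Eventually.of_forall fun k hk => absurd hk (by simp)⟩
  · rintro S S' hSS' ⟨B, hB, h⟩
    exact ⟨B, hB, h.mono fun k hk hS => hk (hSS' hS)⟩
  · rintro S S' ⟨B, hB, h⟩ ⟨B', hB', h'⟩
    refine ⟨max B B', le_max_of_le_left hB, ?_⟩
    filter_upwards [h, h'] with k hk hk' hS hφ
    rcases hS with hS | hS
    · exact (hk hS hφ).trans (by gcongr; exact le_max_left _ _)
    · exact (hk' hS hφ).trans (by gcongr; exact le_max_right _ _)
  · intro w _
    by_cases hw : MapClusterPt w atTop z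
    · obtain ⟨hqw, hne⟩ := hcl w hw
      obtain ⟨ε, hε, η, hη, B, hB, h⟩ := hKL.exists_rpow_le hθ hqw hne
      refine ⟨Metric.ball w ε, mem_nhdsWithin_of_mem_nhds (Metric.ball_mem_nhds w hε), B, hB, ?_⟩
      filter_upwards [hp.eventually (gt_mem_nhds (lt_add_of_pos_right φ hη))] with k hk hball hφ
      exact h (z k) (v k) (p k) (by simpa [dist_eq_norm] using hball) (hv k) (hqz k) hφ hk
    · rw [mapClusterPt_iff_frequently] at hw
      push Not at hw
      obtain ⟨U, hU, hev⟩ := hw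
      exact ⟨U, mem_nhdsWithin_of_mem_nhds hU, 0, le_rfl,
        hev.mono fun k hk hkU => absurd hkU hk⟩

/-! ### Incremental minimization of Bregman models -/

theorem continuous_bregman {F : Rn n → ℝ} (hF : ContDiff ℝ 2 F) :
    Continuous fun y : Rn n × Rn n => bregman F y.1 y.2 := by
  simp only [bregman_eq_fderiv]
  have h1 : Continuous (fderiv ℝ F) := hF.continuous_fderiv (by norm_num)
  have h2 := hF.continuous
  exact ((h2.comp continuous_fst).sub (h2.comp continuous_snd)).sub
    ((h1.comp continuous_snd).clm_apply (continuous_fst.sub continuous_snd))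

theorem hasGradientAt_sum_bregman {N : ℕ} {P : Fin N → Rn n → ℝ}
    (hP : ∀ i, Differentiable ℝ (P i)) (x : Fin N → Rn n) (w : Rn n) :
    HasGradientAt (fun w => ∑ i, bregman (P i) w (x i))
      (∑ i, (gradient (P i) w - gradient (P i) (x i))) w := by
  rw [hasGradientAt_iff_hasFDerivAt, map_sum]
  refine HasFDerivAt.fun_sum fun i _ => ?_
  simp only [bregman_eq_fderiv]
  rw [map_sub, toDual_gradient, toDual_gradient]
  exact ((hP i w).hasFDerivAt.sub_const _).sub
    ((fderiv ℝ (P i) (x i)).hasFDerivAt.comp w ((hasFDerivAt_id w).sub_const (x i)))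

/-- Under an essentially cyclic rule with period `T`, a table entry is never older than `T`. -/
theorem exists_table_eq {N : ℕ} {α : Type*} {I : ℕ → Finset (Fin N)} {T : ℕ}
    (hI : ∀ k : ℕ, (Finset.Icc 1 T).biUnion (fun t => I (k + t)) = Finset.univ)
    {z : ℕ → α} {x : ℕ → Fin N → α}
    (hx : ∀ k i, x (k + 1) i = if i ∈ I (k + 1) then z k else x k i) (m : ℕ) (i : Fin N) :
    ∃ j ≤ T, x (m + T) i = z (m + j) := by
  obtain ⟨t, ht, hit⟩ : ∃ t ∈ Finset.Icc 1 T, i ∈ I (m + t) := by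
    have := Finset.mem_univ i
    rw [← hI m] at this
    simpa using this
  obtain ⟨ht1, htT⟩ := Finset.mem_Icc.1 ht
  have key : ∀ r, t ≤ r → ∃ j ≤ r, x (m + r) i = z (m + j) := by
    intro r hr
    induction r, hr using Nat.le_induction with
    | base =>
      obtain ⟨t', rfl⟩ : ∃ t', t = t' + 1 := ⟨t - 1, by omega⟩
      refine ⟨t', by omega, ?_⟩
      rw [← add_assoc, hx, if_pos (by simpa [add_assoc] using hit)]
    | succ r hr ih =>
      obtain ⟨j, hj, hjx⟩ := ih
      rw [← add_assoc, hx]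
      split_ifs
      · exact ⟨r, by omega, rfl⟩
      · exact ⟨j, by omega, hjx⟩
  exact key T htT

/-- Convergence of an incremental proximal scheme with Bregman distances: `z k` minimizes
`Φ + ∑ i, bregman (P i) · (x k i)` with the growth `κ · (z k)`, and `x k i` is the point at which
the `i`-th table entry was last evaluated. -/
theorem exists_tendsto_stationary_and_rates {N : ℕ} {Φ : Rn n → EReal} {θ μ : ℝ}
    {P : Fin N → Rn n → ℝ} {κ : Rn n → Rn n → ℝ} {I : ℕ → Finset (Fin N)}
    {z : ℕ → Rn n} {x : ℕ → Fin N → Rn n} {p : ℕ → ℝ} {xinit : Rn n}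
    (hlsc : LowerSemicontinuous Φ) (hlev : LevelBounded Φ) (hμ : ∀ w, (μ : EReal) ≤ Φ w)
    (hKL : HasKL Φ θ) (hθ : θ ∈ Ioo (0 : ℝ) 1)
    (hP : ∀ i, ContDiff ℝ 2 (P i)) (hPc : ∀ i, ConvexOn ℝ univ (P i))
    (hκ : ∀ R : ℝ, ∃ a > (0 : ℝ), ∀ w ∈ Metric.closedBall (0 : Rn n) R,
      ∀ y ∈ Metric.closedBall (0 : Rn n) R, a * ‖w - y‖ ^ 2 ≤ κ w y)
    (hI : EssentiallyCyclic I)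
    (hx0 : ∀ i, x 0 i = xinit)
    (hx : ∀ k i, x (k + 1) i = if i ∈ I (k + 1) then z k else x k i)
    (hp : ∀ k, Φ (z k) = p k)
    (hmin : ∀ k w, ((p k + ∑ i, bregman (P i) (z k) (x k i) + κ w (z k) : ℝ) : EReal) ≤
      Φ w + ((∑ i, bregman (P i) w (x k i) : ℝ) : EReal)) :
    ∃ zs, ∃ φ : ℝ, Φ zs = φ ∧ Tendsto z atTop (𝓝 zs) ∧ IsStationary Φ zs ∧
      (1 / 2 < θ → ∃ c > (0 : ℝ), ∀ k : ℕ, 1 ≤ k →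
        p k - φ ≤ c * (k : ℝ) ^ (-(1 / (2 * θ - 1)))) ∧
      (θ ≤ 1 / 2 → RLinear z zs ∧ RLinear p φ) := by
  obtain ⟨T, hT, hIT⟩ := hI
  have hPd : ∀ i, Differentiable ℝ (P i) := fun i => (hP i).differentiable (by norm_num)
  have hκ0 : ∀ w y, 0 ≤ κ w y := by
    intro w y
    obtain ⟨a, ha, h⟩ := hκ (max ‖w‖ ‖y‖)
    exact le_trans (by positivity) (h w (by simp) y (by simp))
  have hb0 : ∀ i w y, 0 ≤ bregman (P i) w y := fun i => bregman_nonneg (hPc i) (hPd i)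
  set V : ℕ → ℝ := fun k => p k + ∑ i, bregman (P i) (z k) (x k i) with hVdef
  have hpV : ∀ k, p k ≤ V k := fun k => by
    have : 0 ≤ ∑ i, bregman (P i) (z k) (x k i) := Finset.sum_nonneg fun i _ => hb0 i _ _
    simp only [hVdef]
    linarith
  have hμp : ∀ k, μ ≤ p k := fun k => by
    have := hμ (z k)
    rw [hp] at this
    exact_mod_cast this
  -- Refreshing a table entry at `z k` makes its Bregman distance to `z k` vanish.
  have hdescκ : ∀ k, V (k + 1) + κ (z k) (z (k + 1)) ≤ V k := by
    intro k
    have h1 := hmin (k + 1) (z k)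
    rw [hp] at h1
    norm_cast at h1
    refine h1.trans (add_le_add_right (Finset.sum_le_sum fun i _ => ?_) _)
    rw [hx]
    split_ifs
    · rw [bregman_self]
      exact hb0 i _ _
    · exact le_rfl
  have hanti : Antitone V := antitone_nat_of_succ_le fun k => by
    linarith [hdescκ k, hκ0 (z k) (z (k + 1))]
  -- The limit value of `V`; it equals `Φ` at every cluster point of `z`.
  obtain ⟨φ, hV⟩ : ∃ φ, Tendsto V atTop (𝓝 φ) :=
    ⟨_, tendsto_atTop_ciInf hanti ⟨μ, by
      rintro _ ⟨k, rfl⟩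
      exact (hμp k).trans (hpV k)⟩⟩
  obtain ⟨R, hzR, hxinit⟩ : ∃ R, (∀ k, z k ∈ Metric.closedBall (0 : Rn n) R) ∧
      xinit ∈ Metric.closedBall (0 : Rn n) R := by
    obtain ⟨R, hR⟩ := (hlev (V 0)).subset_closedBall 0
    refine ⟨max R ‖xinit‖, fun k => ?_, by simp⟩
    refine Metric.closedBall_subset_closedBall (le_max_left _ _) (hR ?_)
    rw [mem_ofPred_eq, hp]
    exact_mod_cast (hpV k).trans (hanti (Nat.zero_le k))
  have hxR : ∀ k i, x k i ∈ Metric.closedBall (0 : Rn n) R := by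
    intro k i
    induction k with
    | zero => rw [hx0]; exact hxinit
    | succ k ih =>
      rw [hx]
      split_ifs
      exacts [hzR k, ih]
  obtain ⟨a, ha, haκ⟩ := hκ R
  have hdesc : ∀ k, a * ‖z (k + 1) - z k‖ ^ 2 ≤ V k - V (k + 1) := fun k => by
    have := haκ _ (hzR k) _ (hzR (k + 1))
    rw [norm_sub_rev] at this
    linarith [hdescκ k]
  choose b hb hbP using fun i => exists_bregman_upper_bound (hP i) R
  have hbs : 0 ≤ ∑ i, b i := Finset.sum_nonneg fun i _ => hb i
  have hzx : ∀ m i, ‖z (m + T) - x (m + T) i‖ ≤ pathLength z m T := by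
    intro m i
    obtain ⟨j, hj, hjx⟩ := exists_table_eq hIT hx m i
    rw [hjx]
    exact norm_sub_le_pathLength hj
  have hgap : ∀ m, V (m + T) ≤ p (m + T) + (∑ i, b i) * pathLength z m T ^ 2 := by
    intro m
    rw [Finset.sum_mul]
    refine add_le_add_right (Finset.sum_le_sum fun i _ => ?_) _
    exact ((hbP i _ (hzR _) _ (hxR _ i)).2).trans
      (mul_le_mul_of_nonneg_left (pow_le_pow_left₀ (norm_nonneg _) (hzx m i) 2) (hb i))
  have hS := tendsto_pathLength ha hdesc hV T
  have hpT : Tendsto p atTop (𝓝 φ) := by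
    rw [← tendsto_add_atTop_iff_nat T]
    have h1 := (tendsto_add_atTop_iff_nat T).2 hV
    have h2 : Tendsto (fun m => V (m + T) - (∑ i, b i) * pathLength z m T ^ 2) atTop (𝓝 φ) := by
      simpa using h1.sub ((hS.pow 2).const_mul (∑ i, b i))
    exact tendsto_of_tendsto_of_tendsto_of_le_of_le h2 h1
      (fun m => by simp only; linarith [hgap m]) (fun m => hpV _)
  have hzx0 : ∀ i, Tendsto (fun k => z k - x k i) atTop (𝓝 0) := fun i => by
    rw [← tendsto_add_atTop_iff_nat T]
    exact squeeze_zero_norm (fun m => hzx m i) hS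
  -- At a cluster point the optimality of the iterates passes to the limit.
  have hcl : ∀ w, MapClusterPt w atTop z → Φ w = φ ∧ IsStationary Φ w := by
    intro w hw
    obtain ⟨ψ, hψ, hzψ⟩ := hw.tendsto_subseq
    have hψ' := hψ.tendsto_atTop
    have hxψ : ∀ i, Tendsto (fun j => x (ψ j) i) atTop (𝓝 w) := fun i => by
      simpa using hzψ.sub ((hzx0 i).comp hψ')
    have hpψ := hpT.comp hψ'
    have hlim : ∀ y (r : ℝ), Φ y = r → φ ≤ r + ∑ i, bregman (P i) y w := by
      intro y r hr
      have hR : Tendsto (fun j => r + ∑ i, bregman (P i) y (x (ψ j) i)) atTop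
          (𝓝 (r + ∑ i, bregman (P i) y w)) :=
        tendsto_const_nhds.add (tendsto_finsetSum _ fun i _ =>
          ((continuous_bregman (hP i)).tendsto (y, w)).comp
            (tendsto_const_nhds.prodMk_nhds (hxψ i)))
      refine le_of_tendsto_of_tendsto hpψ hR (Eventually.of_forall fun j => ?_)
      have h1 := hmin (ψ j) y
      rw [hr] at h1
      norm_cast at h1
      have h2 : 0 ≤ ∑ i, bregman (P i) (z (ψ j)) (x (ψ j) i) :=
        Finset.sum_nonneg fun i _ => hb0 i _ _
      simp only [Function.comp_apply]
      linarith [hκ0 y (z (ψ j))]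
    have hle : Φ w ≤ φ := by
      by_contra! hlt
      obtain ⟨c, hc1, hc2⟩ := exists_between hlt
      have hev := hzψ.eventually (hlsc w c hc2)
      have hcont : Tendsto (fun j => (p (ψ j) : EReal)) atTop (𝓝 (φ : EReal)) :=
        (continuous_coe_real_ereal.tendsto φ).comp hpψ
      refine absurd hc1 (not_lt.2 (ge_of_tendsto hcont (hev.mono fun j hj => ?_)))
      simp only [Function.comp_apply, hp] at hj
      exact hj.le
    have heq : Φ w = φ := by
      induction hw : Φ w with
      | bot => exact absurd (hμ w) (by simp [hw])
      | top => simp [hw] at hle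
      | coe r =>
        rw [hw] at hle
        have h1 := hlim w r hw
        simp only [bregman_self, Finset.sum_const_zero, add_zero] at h1
        exact congrArg _ (le_antisymm (by exact_mod_cast hle) h1)
    refine ⟨heq, ?_⟩
    have hgrad := hasGradientAt_sum_bregman hPd (fun _ => w) w
    simp only [sub_self, Finset.sum_const_zero] at hgrad
    have := neg_mem_regularSubdiff_of_forall_le heq hgrad (fun y => by
      simp only [bregman_self, Finset.sum_const_zero, add_zero]
      induction hy : Φ y with
      | bot => exact absurd (hμ y) (by simp [hy])
      | top => simp
      | coe r => exact_mod_cast hlim y r hy)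
    rwa [neg_zero] at this
  -- The subgradients of `Φ` given by the optimality of the iterates.
  set v : ℕ → Rn n := fun k => -∑ i, (gradient (P i) (z k) - gradient (P i) (x k i)) with hvdef
  have hv : ∀ k, v k ∈ regularSubdiff Φ (z k) := fun k =>
    neg_mem_regularSubdiff_of_forall_le (hp k) (hasGradientAt_sum_bregman hPd (x k) (z k))
      (fun w => le_trans (by exact_mod_cast le_add_of_nonneg_right (hκ0 w (z k))) (hmin k w))
  have hvS : ∀ m, ‖v (m + T)‖ ≤ (∑ i, b i) * pathLength z m T := by
    intro m
    rw [hvdef, norm_neg, Finset.sum_mul]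
    refine (norm_sum_le _ _).trans (Finset.sum_le_sum fun i _ => ?_)
    exact ((hbP i _ (hzR _) _ (hxR _ i)).1).trans
      (mul_le_mul_of_nonneg_left (hzx m i) (hb i))
  obtain ⟨B, hB, hKLz⟩ := hKL.exists_eventually_rpow_le hθ (isCompact_closedBall (0 : Rn n) R) hzR
    hp hv hpT (fun w hw => ⟨(hcl w hw).1, 0,
      regularSubdiff_subset_limitingSubdiff _ _ (hcl w hw).2⟩)
  have hKLS : ∀ᶠ m in atTop, φ < p (m + T) →
      (p (m + T) - φ) ^ θ ≤ B * (∑ i, b i) * pathLength z m T := by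
    filter_upwards [(tendsto_add_atTop_nat T).eventually hKLz] with m hm hφm
    calc _ ≤ _ := hm hφm
      _ ≤ B * ((∑ i, b i) * pathLength z m T) := by gcongr; exact hvS m
      _ = _ := by ring
  obtain ⟨zs, hzs, h1, h2⟩ := exists_tendsto_and_rates hT ha hbs (mul_nonneg hB hbs) hθ hdesc hV
    hpV hgap hKLS
  exact ⟨zs, φ, (hcl zs hzs.mapClusterPt).1, hzs, (hcl zs hzs.mapClusterPt).2, h1, h2⟩

/-! ### The algorithm as incremental minimization of Bregman models -/

theorem IsC2.exists_real {N : ℕ} {f : Fin N → Rn n → EReal} (hf : ∀ i, IsC2 (f i)) :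
    ∃ F : Fin N → Rn n → ℝ, (∀ i, ContDiff ℝ 2 (F i)) ∧ f = fun i x => (F i x : EReal) := by
  choose F hF hfF using hf
  exact ⟨F, hF, funext fun i => funext fun x => hfF i x⟩

@[simp]
theorem realPart_coe (F : Rn n → ℝ) : realPart (fun x => (F x : EReal)) = F :=
  funext fun x => EReal.toReal_coe (F x)

@[simp]
theorem dom_coe (F : Rn n → ℝ) : dom (fun x => (F x : EReal)) = univ :=
  eq_univ_of_forall fun x => EReal.coe_lt_top (F x)

theorem coe_sum {ι : Type*} (s : Finset ι) (F : ι → ℝ) :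
    ((∑ i ∈ s, F i : ℝ) : EReal) = ∑ i ∈ s, (F i : EReal) := by
  classical
  induction s using Finset.induction_on with
  | empty => simp
  | insert i s hi ih => rw [Finset.sum_insert hi, Finset.sum_insert hi, EReal.coe_add, ih]

theorem cost_coe {N : ℕ} (F : Fin N → Rn n → ℝ) (g : Rn n → EReal) (x : Rn n) :
    cost (fun i x => (F i x : EReal)) g x =
      ((1 / (N : ℝ) * ∑ i, F i x : ℝ) : EReal) + g x := by
  rw [cost, ← coe_sum, ← EReal.coe_mul]

theorem coe_realPart {g : Rn n → EReal} (hg : IsProper g) {x : Rn n} (hx : x ∈ dom g) :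
    ((realPart g x : ℝ) : EReal) = g x :=
  EReal.coe_toReal (ne_of_lt hx) (hg.1 x)

theorem lowerSemicontinuous_cost_coe {N : ℕ} {F : Fin N → Rn n → ℝ} (hF : ∀ i, Continuous (F i))
    {g : Rn n → EReal} (hg : LowerSemicontinuous g) :
    LowerSemicontinuous (cost (fun i x => (F i x : EReal)) g) := by
  rw [funext (cost_coe F g)]
  refine LowerSemicontinuous.add' ?_ hg fun x =>
    EReal.continuousAt_add (Or.inl (EReal.coe_ne_top _)) (Or.inl (EReal.coe_ne_bot _))
  refine (continuous_coe_real_ereal.comp ?_).lowerSemicontinuous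
  fun_prop

theorem gradient_smul_sub_smul {F H : Rn n → ℝ} (hF : Differentiable ℝ F)
    (hH : Differentiable ℝ H) (a b : ℝ) (x : Rn n) :
    gradient (fun y => a * H y - b * F y) x = a • gradient H x - b • gradient F x := by
  refine HasGradientAt.gradient ?_
  rw [hasGradientAt_iff_hasFDerivAt, map_sub, map_smul, map_smul, toDual_gradient,
    toDual_gradient]
  exact ((hH x).hasFDerivAt.const_mul a).sub ((hF x).hasFDerivAt.const_mul b)

/-- The table is summarized by the points `x k i` at which its entries were last evaluated. -/
theorem IsBFinitoRun.exists_points {N : ℕ} {f h : Fin N → Rn n → EReal} {g : Rn n → EReal}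
    {γ : Fin N → ℝ} {xinit : Rn n} {I : ℕ → Finset (Fin N)} {z : ℕ → Rn n}
    {s : ℕ → Fin N → Rn n} {st : ℕ → Rn n} (hrun : IsBFinitoRun f h g γ xinit I z s st) :
    ∃ x : ℕ → Fin N → Rn n, (∀ i, x 0 i = xinit) ∧
      (∀ k i, x (k + 1) i = if i ∈ I (k + 1) then z k else x k i) ∧
      ∀ k, st k = ∑ i, tableEntry f h γ i (x k i) := by
  let x : ℕ → Fin N → Rn n := fun k =>
    Nat.rec (fun _ => xinit) (fun k y i => if i ∈ I (k + 1) then z k else y i) k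
  have hx : ∀ k i, x (k + 1) i = if i ∈ I (k + 1) then z k else x k i := fun _ _ => rfl
  have hs : ∀ k i, s k i = tableEntry f h γ i (x k i) := by
    intro k i
    induction k with
    | zero => exact hrun.s_zero i
    | succ k ih =>
      rw [hrun.s_step, hx]
      split_ifs
      exacts [rfl, ih]
  have hst : ∀ k, st k = ∑ i, s k i := by
    intro k
    induction k with
    | zero => exact hrun.st_zero
    | succ k ih =>
      have hsum : ∑ i ∈ I (k + 1), (s (k + 1) i - s k i) = ∑ i, (s (k + 1) i - s k i) :=
        Finset.sum_subset (Finset.subset_univ _) fun i _ hi => by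
          rw [hrun.s_step, if_neg hi, sub_self]
      rw [hrun.st_step, ih, hsum, Finset.sum_sub_distrib]
      abel
  exact ⟨x, fun _ => rfl, hx, fun k => by simp only [hst, hs]⟩

/-- An inner proximal point is finite-valued for `g`, and by convexity of `g` it minimizes the
Bregman model of the cost with the growth `∑ i, (1 / γ i) * bregman (H i) w z`. -/
theorem model_le_of_mem_innerProx {N : ℕ} {F H : Fin N → Rn n → ℝ} {g : Rn n → EReal}
    {γ : Fin N → ℝ} (hH : ∀ i, Differentiable ℝ (H i))
    (hgp : IsProper g) (hg : IsConvexFun g) {z : Rn n} (x : Fin N → Rn n)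
    (hz : z ∈ innerProx (fun i x => (H i x : EReal)) g γ
      (∑ i, gradient (fun y => 1 / γ i * H i y - 1 / (N : ℝ) * F i y) (x i))) :
    z ∈ dom g ∧ ∀ w ∈ dom g,
      1 / (N : ℝ) * ∑ i, F i z + realPart g z +
          ∑ i, bregman (fun y => 1 / γ i * H i y - 1 / (N : ℝ) * F i y) z (x i) +
          ∑ i, 1 / γ i * bregman (H i) w z ≤
        1 / (N : ℝ) * ∑ i, F i w + realPart g w +
          ∑ i, bregman (fun y => 1 / γ i * H i y - 1 / (N : ℝ) * F i y) w (x i) := by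
  obtain ⟨-, hfin, hopt⟩ := hz
  set σ := ∑ i, gradient (fun y => 1 / γ i * H i y - 1 / (N : ℝ) * F i y) (x i) with hσ
  set Q : Rn n → ℝ := fun w => ∑ i, 1 / γ i * H i w - inner ℝ σ w with hQ
  have hrew : ∀ w, g w + ∑ i, ((1 / γ i : ℝ) : EReal) * (H i w : EReal) -
      ((inner ℝ σ w : ℝ) : EReal) = g w + (Q w : EReal) := by
    intro w
    simp only [← EReal.coe_mul]
    rw [← coe_sum, hQ, EReal.coe_sub, ← EReal.coe_sub, sub_eq_add_neg, add_assoc,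
      ← sub_eq_add_neg, ← EReal.coe_sub]
  simp only [hrew] at hfin hopt
  have hzdom : z ∈ dom g := by
    refine (lt_top_iff_ne_top.2 fun h => ?_ : g z < ⊤)
    rw [h, EReal.top_add_coe] at hfin
    exact lt_irrefl _ hfin
  refine ⟨hzdom, fun w hw => ?_⟩
  have hQgrad : HasGradientAt Q (∑ i, (1 / γ i) • gradient (H i) z - σ) z := by
    rw [hasGradientAt_iff_hasFDerivAt, map_sub, map_sum]
    refine (HasFDerivAt.fun_sum fun i _ => ?_).sub (InnerProductSpace.toDual ℝ _ σ).hasFDerivAt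
    rw [map_smul, toDual_gradient]
    exact (hH i z).hasFDerivAt.const_mul _
  have hkey := zero_le_sub_add_inner_of_isMinOn (G := realPart g) (w := w) hg hzdom hw hQgrad
    (fun y hy => by
      have := hopt y (mem_univ y)
      rw [← coe_realPart hgp hzdom, ← coe_realPart hgp hy] at this
      exact_mod_cast this)
  have e1 : ∑ i, bregman (fun y => 1 / γ i * H i y - 1 / (N : ℝ) * F i y) w (x i) -
      ∑ i, bregman (fun y => 1 / γ i * H i y - 1 / (N : ℝ) * F i y) z (x i) =
      (∑ i, 1 / γ i * (H i w - H i z)) - 1 / (N : ℝ) * (∑ i, F i w - ∑ i, F i z) -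
        inner ℝ σ (w - z) := by
    rw [hσ, sum_inner, ← Finset.sum_sub_distrib, ← Finset.sum_sub_distrib, Finset.mul_sum,
      ← Finset.sum_sub_distrib, ← Finset.sum_sub_distrib]
    refine Finset.sum_congr rfl fun i _ => ?_
    rw [bregman, bregman, ← sub_sub_sub_cancel_right w z (x i),
      inner_sub_right _ (w - x i) (z - x i)]
    ring
  have e2 : ∑ i, 1 / γ i * bregman (H i) w z =
      ∑ i, 1 / γ i * (H i w - H i z) - inner ℝ (∑ i, (1 / γ i) • gradient (H i) z) (w - z) := by
    rw [sum_inner, ← Finset.sum_sub_distrib]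
    refine Finset.sum_congr rfl fun i _ => ?_
    rw [bregman, real_inner_smul_left]
    ring
  rw [inner_sub_left] at hkey
  linarith

end BFinito

open BFinito in
theorem mainTheorem5 {n N : ℕ} (hN : 0 < N)
    (f h : Fin N → Rn n → EReal) (g : Rn n → EReal) (L γ : Fin N → ℝ)
    (hbasic : BasicAssumption f h g L γ)
    (hf : ∀ i, IsC2 (f i)) (hh : ∀ i, IsC2 (h i))
    (hhess : ∀ i x v, v ≠ 0 → 0 < fderiv ℝ (fderiv ℝ (realPart (h i))) x v v)
    (θ : ℝ) (hθ : θ ∈ Set.Ioo (0 : ℝ) 1)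
    (hKL : HasKL (cost f g) θ) (hlev : LevelBounded (cost f g))
    (hg : IsConvexFun g)
    (xinit : Rn n) (I : ℕ → Finset (Fin N)) (hI : EssentiallyCyclic I)
    (z : ℕ → Rn n) (s : ℕ → Fin N → Rn n) (st : ℕ → Rn n)
    (hrun : IsBFinitoRun f h g γ xinit I z s st) :
    (∀ k, z k ∈ dom (cost f g)) ∧
    ∃ zstar : Rn n,
      Filter.Tendsto z Filter.atTop (nhds zstar) ∧ IsStationary (cost f g) zstar ∧
      (1 / 2 < θ → ∃ c > (0 : ℝ), ∀ k : ℕ, 1 ≤ k →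
        cost f g (z k) - cost f g zstar ≤
          ((c * (k : ℝ) ^ (-(1 / (2 * θ - 1))) : ℝ) : EReal)) ∧
      (θ ≤ 1 / 2 →
        RLinear z zstar ∧
        RLinear (fun k => realPart (cost f g) (z k)) (realPart (cost f g) zstar)) := by
  obtain ⟨F, hF, rfl⟩ := IsC2.exists_real hf
  obtain ⟨H, hH, rfl⟩ := IsC2.exists_real hh
  have hFd : ∀ i, Differentiable ℝ (F i) := fun i => (hF i).differentiable (by norm_num)
  have hHd : ∀ i, Differentiable ℝ (H i) := fun i => (hH i).differentiable (by norm_num)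
  simp only [realPart_coe] at hhess
  set P : Fin N → Rn n → ℝ := fun i y => 1 / γ i * H i y - 1 / (N : ℝ) * F i y with hPdef
  set p : ℕ → ℝ := fun k => 1 / (N : ℝ) * ∑ i, F i (z k) + realPart g (z k) with hpdef
  obtain ⟨x, hx0, hx, hst⟩ := hrun.exists_points
  have hmodel := fun k => model_le_of_mem_innerProx (F := F) (γ := γ) (z := z k) hHd
    hbasic.g_proper hg (x k) (by
      have h1 := hrun.z_step k
      simp only [hst, tableEntry, realPart_coe] at h1
      simpa only [gradient_smul_sub_smul (hFd _) (hHd _)] using h1)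
  have hp : ∀ k, cost (fun i x => (F i x : EReal)) g (z k) = p k := fun k => by
    rw [cost_coe, hpdef, EReal.coe_add, coe_realPart hbasic.g_proper (hmodel k).1]
  have hN' : (0 : ℝ) < N := by exact_mod_cast hN
  have hPc : ∀ i, ConvexOn ℝ univ (P i) := by
    intro i
    have hrel := hbasic.rel_smooth i
    obtain ⟨hγ, hγL⟩ := hbasic.stepsize i
    have hHc : ConvexOn ℝ univ (H i) := by
      have := hrel.legendre.strictly_convex.convexOn
      rwa [dom_coe, realPart_coe] at this
    have hsub := hrel.convex_sub
    simp only [dom_coe, interior_univ, realPart_coe] at hsub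
    -- `P i` is the conic combination `(1 / γ - L / N) h + (1 / N) (L h - f)` of convex functions.
    have hcoef : 0 ≤ 1 / γ i - L i / N := by
      rw [sub_nonneg, div_le_div_iff₀ hN' hγ]
      linarith
    refine ((hHc.smul hcoef).add (hsub.smul (by positivity : 0 ≤ 1 / (N : ℝ)))).congr
      fun y _ => ?_
    simp only [Pi.add_apply, smul_eq_mul, hPdef]
    ring
  obtain ⟨ym, -, hym, hymin⟩ := hbasic.solution_exists
  have hclC : closure (domC fun i x => (H i x : EReal)) = univ := by simp [domC]
  rw [hclC] at hymin
  have hbot : ∀ y, cost (fun i x => (F i x : EReal)) g y ≠ ⊥ := fun y => by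
    rw [cost_coe, ne_eq, EReal.add_eq_bot_iff]
    exact not_or.2 ⟨EReal.coe_ne_bot _, hbasic.g_proper.1 y⟩
  obtain ⟨zs, φ, hφ, hzs, hstat, hsub, hlin⟩ := exists_tendsto_stationary_and_rates
    (κ := fun w y => ∑ i, 1 / γ i * bregman (H i) w y) (P := P) (p := p)
    (μ := (cost (fun i x => (F i x : EReal)) g ym).toReal)
    (lowerSemicontinuous_cost_coe (fun i => (hF i).continuous) hbasic.g_lsc) hlev
    (fun w => by
      rw [EReal.coe_toReal hym.ne (hbot ym)]
      exact hymin w (mem_univ w))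
    hKL hθ
    (fun i => (contDiff_const.mul (hH i)).sub (contDiff_const.mul (hF i))) hPc
    (fun R => by
      choose a ha haH using fun i => exists_bregman_lower_bound (hH i) (hhess i) R
      have hγ := fun i => (hbasic.stepsize i).1
      have : Nonempty (Fin N) := ⟨⟨0, hN⟩⟩
      refine ⟨∑ i, 1 / γ i * a i, Finset.sum_pos (fun i _ => mul_pos (one_div_pos.2 (hγ i)) (ha i))
        Finset.univ_nonempty, fun w hw y hy => ?_⟩
      rw [Finset.sum_mul]
      refine Finset.sum_le_sum fun i _ => ?_
      rw [mul_assoc]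
      exact mul_le_mul_of_nonneg_left (haH i w hw y hy) (one_div_pos.2 (hγ i)).le)
    hI hx0 hx hp
    (fun k w => by
      rw [cost_coe]
      by_cases hw : w ∈ dom g
      · rw [← coe_realPart hbasic.g_proper hw]
        exact_mod_cast (hmodel k).2 w hw
      · have : g w = ⊤ := not_lt_top_iff.1 hw
        rw [this, EReal.coe_add_top, EReal.top_add_coe]
        exact le_top)
  refine ⟨fun k => ?_, zs, hzs, hstat, fun h => ?_, fun h => ⟨(hlin h).1, ?_⟩⟩
  · rw [dom, mem_ofPred_eq, hp]
    exact EReal.coe_lt_top _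
  · obtain ⟨c, hc, hrate⟩ := hsub h
    refine ⟨c, hc, fun k hk => ?_⟩
    rw [hp, hφ]
    exact_mod_cast hrate k hk
  · simp only [BFinito.realPart, hp, hφ, EReal.toReal_coe]
    exact (hlin h).2
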